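/- Let $(\Omega,\mathcal E,\mathbb P)$ be a probability space, $\mathcal F\subseteq\mathcal E$ a sub-$\sigma$-algebra, and let $L^0(\mathcal E)$, $L^0(\mathcal F)$ be the rings of (classes modulo a.s. equality of) real-valued $\mathcal E$-, respectively $\mathcal F$-measurable random variables, with the a.s. order. Let $\varphi:[0,\infty)\to[0,\infty]$ be a Young function, i.e. nondecreasing, left-continuous, convex, finite in a neighbourhood of $0$, with $\varphi(0)=0$ and $\lim_{t\to\infty}\varphi(t)=\infty$, and let $\varphi^*(s)=\sup_{t\ge0}(ts-\varphi(t))$. For $\psi\in\{\varphi,\varphi^*\}$ put $$L^\psi_{\mathcal F}(\mathcal E)=\{x\in L^0(\mathcal E):\ \mathbb E[\psi(|x|\lambda^{-1})\,|\,\mathcal F]<\infty\text{ a.s. for some }\lambda\in L^0(\mathcal F),\ \lambda>0\text{ a.s.}\},$$ and $L^1_{\mathcal F}(\mathcal E)=\{x\in L^0(\mathcal E):\mathbb E[|x|\,|\,\mathcal F]<\infty\text{ a.s.}\}$. For $x\in L^1_{\mathcal F}(\mathcal E)$ one can write $x=\sum_k 1_{A_k}x_k$ with a countable partition $(A_k)$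 of $\Omega$ into sets of $\mathcal F$ and integrable $x_k$, and $\mathbb E[x|\mathcal F]:=\sum_k1_{A_k}\mathbb E[x_k|\mathcal F]$, which does not depend on the choice. A concatenation of $(x_k)$ along such a partition $(A_k)$ is the element $x$ with $1_{A_k}x=1_{A_k}x_k$ for all $k$; the countable concatenation hull of a set is the set of all concatenations of its elements, the set has the countable concatenation property if it equals its hull, and a function is stable if it preserves concatenations. The conditional set generated by a set $S$ is the collection of all $x|A$, $x\in S$, $A\in\mathcal F$, where $x|A=y|B$ iff $A=B$ a.s. and $1_Ax=1_By$ (for functions with values in $L^0(\mathcal F)$ all this is meant pointwise); $[x\,;\,x\in S]$ denotes the conditional set generated by the hull of $S$. A conditionally linear functional on $\mathbf L^\varphi$ is a stable $L^0(\mathcal F)$-linear map $\mu:L^\varphi_{\mathcal F}(\mathcal E)\to L^0(\mathcal F)$. It is conditionally order continuous if * (order boundedness) for every $x\in L^\varphi_{\mathcal F}(\mathcal E)$ there is $0\le y\in L^0(\mathcal F)$ such that $-y\le\mu(z)\le y$ for all $z\in L^\varphi_{\mathcal F}(\mathcal E)$ with $-|x|\le z\le|x|$, and * for every non-empty downward directed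 set $D\subseteq L^\varphi_{\mathcal F}(\mathcal E)$ with the countable concatenation property and $\operatorname{ess\,inf}D=0$ one has $\operatorname{ess\,inf}_{x\in D}|\mu(x)|=0$. Let $[\mathbf L^\varphi]^\sim_n$ be the conditional set generated by the conditionally order continuous, conditionally linear functionals on $\mathbf L^\varphi$. Then: 1. $xy\in L^1_{\mathcal F}(\mathcal E)$ for all $x\in L^\varphi_{\mathcal F}(\mathcal E)$ and $y\in L^{\varphi^*}_{\mathcal F}(\mathcal E)$, so that $\mu_y(x):=\mathbb E[xy|\mathcal F]$ defines a map $\mu_y:L^\varphi_{\mathcal F}(\mathcal E)\to L^0(\mathcal F)$. 2. The conditionally order continuous, conditionally linear functionals on $\mathbf L^\varphi$ are exactly the maps $\mu_y$ with $y\in L^{\varphi^*}_{\mathcal F}(\mathcal E)$. 3. As conditional sets, $[\mathbf L^\varphi]^\sim_n=[\boldsymbol\mu_{\mathbf y}\,;\,\mathbf y\in\mathbf L^{\varphi^*}]$. 4. The map $y\mapsto\mu_y$ is injective on $L^{\varphi^*}_{\mathcal F}(\mathcal E)$; hence it identifies $L^{\varphi^*}_{\mathcal F}(\mathcal E)$ with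 the set of conditionally order continuous, conditionally linear functionals. -/

import Mathlib

open MeasureTheory Set Filter Topology
open scoped NNReal ENNReal

noncomputable section

namespace CondOrlicz

/-! Throughout, `mΩ` is the large σ-algebra of the probability space `(Ω, mΩ, P)`, and `F` is a
sub-σ-algebra. `L⁰(mΩ)` is Mathlib's space `Ω →ₘ[P] ℝ` of random variables modulo almost sure
equality, with the almost sure order. -/

instance instCommRingL0 {Ω : Type*} [MeasurableSpace Ω] {P : Measure Ω} :
    CommRing (Ω →ₘ[P] ℝ) :=
  { (inferInstance : AddCommGroup (Ω →ₘ[P] ℝ)), (inferInstance : CommMonoid (Ω →ₘ[P] ℝ)) with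
    left_distrib := by
      intro a b c
      induction a, b, c using AEEqFun.induction_on₃ with
      | _ f hf g hg h hh => simp [AEEqFun.mk_add_mk, AEEqFun.mk_mul_mk, mul_add]
    right_distrib := by
      intro a b c
      induction a, b, c using AEEqFun.induction_on₃ with
      | _ f hf g hg h hh => simp [AEEqFun.mk_add_mk, AEEqFun.mk_mul_mk, add_mul]
    zero_mul := by
      intro a
      induction a using AEEqFun.induction_on with
      | _ f hf => rw [AEEqFun.zero_def, AEEqFun.mk_mul_mk]; congr 1; ext; simp
    mul_zero := by
      intro a
      induction a using AEEqFun.induction_on with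
      | _ f hf => rw [AEEqFun.zero_def, AEEqFun.mk_mul_mk]; congr 1; ext; simp }

variable {Ω : Type*} (F : MeasurableSpace Ω) [mΩ : MeasurableSpace Ω] (P : Measure Ω)

/-- `L⁰(F)`: the classes in `L⁰(mΩ)` that have an `F`-measurable representative. -/
def L0F : Subring (Ω →ₘ[P] ℝ) where
  carrier := {x | AEStronglyMeasurable[F] x P}
  mul_mem' {a b} ha hb := (AEStronglyMeasurable.mul ha hb).congr (AEEqFun.coeFn_mul a b).symm
  add_mem' {a b} ha hb := (AEStronglyMeasurable.add ha hb).congr (AEEqFun.coeFn_add a b).symm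
  one_mem' := (aestronglyMeasurable_const (b := (1 : ℝ))).congr AEEqFun.coeFn_one.symm
  zero_mem' := (aestronglyMeasurable_const (b := (0 : ℝ))).congr AEEqFun.coeFn_zero.symm
  neg_mem' {a} ha := (AEStronglyMeasurable.neg ha).congr (AEEqFun.coeFn_neg a).symm

/-! ### Concatenations and conditional sets -/

/-- The sets of the σ-algebra `F`. -/
abbrev FSet := {A : Set Ω // MeasurableSet[F] A}

/-- The countable partitions of `Ω` into sets of `F` (some of them may be empty). -/
def IsPartition (A : ℕ → FSet F) : Prop :=
  Pairwise (fun i j => Disjoint (A i).1 (A j).1) ∧ ⋃ k, (A k).1 = univ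

variable {F} in
/-- The class of the indicator function `1_A` in `L⁰(F)`. -/
def ind (hF : F ≤ mΩ) (A : FSet F) : L0F F P :=
  ⟨AEEqFun.mk (A.1.indicator fun _ => (1 : ℝ))
      ((aestronglyMeasurable_const).indicator (hF _ A.2)),
    (StronglyMeasurable.aestronglyMeasurable
      ((@stronglyMeasurable_const _ _ F _ (1 : ℝ)).indicator A.2)).congr
      (AEEqFun.coeFn_mk _ _).symm⟩

section Module

variable {F} (hF : F ≤ mΩ) {V W : Type*} [AddCommGroup V] [Module (L0F F P) V]
  [AddCommGroup W] [Module (L0F F P) W]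

/-- `x` is a concatenation `∑ 1_{A_k} x_k` of `(x_k)` along the partition `(A_k)`. -/
def IsConcat (A : ℕ → FSet F) (xs : ℕ → V) (x : V) : Prop :=
  ∀ k, ind P hF (A k) • x = ind P hF (A k) • xs k

/-- The countable concatenation hull of `S`. -/
def ccHull (S : Set V) : Set V :=
  {x | ∃ A : ℕ → FSet F, IsPartition F A ∧ ∃ xs : ℕ → V, (∀ k, xs k ∈ S) ∧ IsConcat P hF A xs x}

/-- The countable concatenation property. -/
def HasCCP (S : Set V) : Prop := ccHull P hF S = S

/-- Stable functions: those preserving countable concatenations. -/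
def IsStable (f : V → W) : Prop :=
  ∀ A : ℕ → FSet F, IsPartition F A → ∀ (xs : ℕ → V) (x : V),
    IsConcat P hF A xs x → IsConcat P hF A (fun k => f (xs k)) (f x)

/-- The relation on `V × F` whose classes are the `x|A`: `x|A = y|B` if and only if `A = B`
almost surely and `1_A x = 1_B y`. -/
def condSetoid (V : Type*) [AddCommGroup V] [Module (L0F F P) V] : Setoid (V × FSet F) where
  r p q := p.2.1 =ᵐ[P] q.2.1 ∧ ind P hF p.2 • p.1 = ind P hF q.2 • q.1
  iseqv := ⟨fun _ => ⟨ae_eq_refl _, rfl⟩, fun h => ⟨h.1.symm, h.2.symm⟩,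
    fun h h' => ⟨h.1.trans h'.1, h.2.trans h'.2⟩⟩

/-- The conditional set generated by `S`: the collection of all `x|A` with `x ∈ S`, `A ∈ F`. -/
def condSet (S : Set V) : Set (Quotient (condSetoid P hF V)) :=
  {q | ∃ x ∈ S, ∃ A : FSet F, q = Quotient.mk (condSetoid P hF V) (x, A)}

/-- The set-builder notation `[x ; x ∈ S]`: the conditional set generated by the countable
concatenation hull of `S`. -/
def condBuilder (S : Set V) : Set (Quotient (condSetoid P hF V)) := condSet P hF (ccHull P hF S)

end Module

/-! ### Conditional expectation -/

/-- The module `L¹_F(mΩ)` of all `x` with `E[|x| | F] < ∞` almost surely. -/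
def L1F : Set (Ω →ₘ[P] ℝ) :=
  {x | ∀ᵐ ω ∂P, condLExp F P (fun ω' => ‖x ω'‖ₑ) ω < ∞}

/-- `z = E[x | F]` in the extended sense: `x = ∑ 1_{A_k} x_k` with integrable `x_k` and
`z = ∑ 1_{A_k} E[x_k | F]`. -/
def IsCondExp (x : Ω →ₘ[P] ℝ) (z : L0F F P) : Prop :=
  ∃ A : ℕ → FSet F, IsPartition F A ∧ ∃ xs : ℕ → Ω →ₘ[P] ℝ, ∀ k,
    Integrable (xs k) P ∧
    (∀ᵐ ω ∂P, ω ∈ (A k).1 → x ω = xs k ω) ∧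
    (∀ᵐ ω ∂P, ω ∈ (A k).1 → (z : Ω →ₘ[P] ℝ) ω = (P[xs k | F]) ω)

variable {F P} in
/-- The extended conditional expectation does not depend on the chosen decomposition. -/
theorem IsCondExp.unique [IsFiniteMeasure P] {x : Ω →ₘ[P] ℝ} {z z' : L0F F P}
    (h : IsCondExp F P x z) (h' : IsCondExp F P x z') : z = z' := by
  obtain ⟨A, hA, xs, hx⟩ := h
  obtain ⟨B, hB, ys, hy⟩ := h'
  have key : ∀ i j, ∀ᵐ ω ∂P, ω ∈ (A i).1 → ω ∈ (B j).1 →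
      (z : Ω →ₘ[P] ℝ) ω = (z' : Ω →ₘ[P] ℝ) ω := by
    intro i j
    have hm : MeasurableSet[F] ((A i).1 ∩ (B j).1) := (A i).2.inter (B j).2
    have e : ((A i).1 ∩ (B j).1).indicator (xs i) =ᵐ[P]
        ((A i).1 ∩ (B j).1).indicator (ys j) := by
      filter_upwards [(hx i).2.1, (hy j).2.1] with ω h1 h2
      by_cases hω : ω ∈ (A i).1 ∩ (B j).1
      · rw [indicator_of_mem hω, indicator_of_mem hω, ← h1 hω.1, ← h2 hω.2]
      · rw [indicator_of_notMem hω, indicator_of_notMem hω]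
    filter_upwards [(hx i).2.2, (hy j).2.2, condExp_congr_ae (m := F) e,
      condExp_indicator (hx i).1 hm, condExp_indicator (hy j).1 hm] with ω h1 h2 h3 h4 h5 ha hb
    rw [h1 ha, h2 hb]
    have hab : ω ∈ (A i).1 ∩ (B j).1 := ⟨ha, hb⟩
    rw [h4, h5, indicator_of_mem hab, indicator_of_mem hab] at h3
    exact h3
  apply Subtype.ext
  apply AEEqFun.ext
  filter_upwards [ae_all_iff.2 fun i => ae_all_iff.2 (key i)] with ω hω
  obtain ⟨i, hi⟩ := mem_iUnion.1 (hA.2 ▸ mem_univ ω : ω ∈ ⋃ k, (A k).1)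
  obtain ⟨j, hj⟩ := mem_iUnion.1 (hB.2 ▸ mem_univ ω : ω ∈ ⋃ k, (B k).1)
  exact hω i j hi hj

open Classical in
/-- The extended conditional expectation `E[x | F]`, for `x` in `L¹_F(mΩ)`; the value for other
`x` is irrelevant. -/
def condE (x : Ω →ₘ[P] ℝ) : L0F F P :=
  if h : ∃ z, IsCondExp F P x z then h.choose else 0

/-! ### Young functions and Orlicz-type modules -/

/-- Young functions `φ : [0,∞) → [0,∞]`. -/
structure IsYoung (φ : ℝ≥0 → ℝ≥0∞) : Prop where
  mono : Monotone φ
  leftContinuous : ∀ t, ContinuousWithinAt φ (Iic t) t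
  convex : ConvexOn ℝ≥0 univ φ
  finite_near_zero : ∀ᶠ t in 𝓝 0, φ t < ∞
  map_zero : φ 0 = 0
  tendsto_top : Tendsto φ atTop (𝓝 ∞)

/-- The conjugate `φ*(s) = sup_{t ≥ 0} (t s - φ(t))`. The subtraction is truncated at `0`, which
does not change the supremum, as `t = 0` contributes `0` for a Young function. -/
def conj (φ : ℝ≥0 → ℝ≥0∞) (s : ℝ≥0) : ℝ≥0∞ := ⨆ t : ℝ≥0, ((t * s : ℝ≥0) : ℝ≥0∞) - φ t

/-- The set `L^φ_F(mΩ)` of all `x` such that `E[φ(|x| λ⁻¹) | F] < ∞` almost surely for some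
`λ ∈ L⁰(F)` with `λ > 0` almost surely. -/
def orliczSet (φ : ℝ≥0 → ℝ≥0∞) : Set (Ω →ₘ[P] ℝ) :=
  {x | ∃ l : L0F F P, (∀ᵐ ω ∂P, 0 < (l : Ω →ₘ[P] ℝ) ω) ∧
    ∀ᵐ ω ∂P, condLExp F P (fun ω' => φ (‖x ω'‖₊ * ‖(l : Ω →ₘ[P] ℝ) ω'‖₊⁻¹)) ω < ∞}

variable {φ : ℝ≥0 → ℝ≥0∞}

/-- The Orlicz-type module `L^φ_F(mΩ)`, as an `L⁰(F)`-submodule of `L⁰(mΩ)`. -/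
def orlicz (hφ : IsYoung φ) : Submodule (L0F F P) (Ω →ₘ[P] ℝ) where
  carrier := orliczSet F P φ
  zero_mem' := by
    refine ⟨1, ?_, ?_⟩
    · filter_upwards [AEEqFun.coeFn_one (μ := P) (α := Ω) (β := ℝ)] with ω h
      rw [OneMemClass.coe_one, h]; simp
    · have : (fun ω' => φ (‖(0 : Ω →ₘ[P] ℝ) ω'‖₊ *
          ‖((1 : L0F F P) : Ω →ₘ[P] ℝ) ω'‖₊⁻¹)) =ᵐ[P] 0 := by
        filter_upwards [AEEqFun.coeFn_zero (μ := P) (α := Ω) (β := ℝ)] with ω h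
        rw [h]; simp [hφ.map_zero]
      filter_upwards [condLExp_congr_ae (mΩ := F) this] with ω h
      rw [h, condLExp_zero]; simp
  add_mem' := by
    rintro x y ⟨l, hl, hx⟩ ⟨k, hk, hy⟩
    have e1 := AEEqFun.coeFn_add (l : Ω →ₘ[P] ℝ) k
    have e2 := AEEqFun.coeFn_add ((l : Ω →ₘ[P] ℝ) + (k : Ω →ₘ[P] ℝ))
      ((l : Ω →ₘ[P] ℝ) + (k : Ω →ₘ[P] ℝ))
    refine ⟨(l + k) + (l + k), ?_, ?_⟩
    · filter_upwards [hl, hk, e1, e2] with ω h1 h2 h3 h4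
      simp only [Subring.coe_add, h4, h3, Pi.add_apply]
      positivity
    · have hmeas : AEMeasurable (fun ω => φ (‖x ω‖₊ * ‖(l : Ω →ₘ[P] ℝ) ω‖₊⁻¹)) P :=
        (hφ.mono.measurable.comp (x.measurable.nnnorm.mul
          (l : Ω →ₘ[P] ℝ).measurable.nnnorm.inv)).aemeasurable
      have hle : (fun ω => φ (‖(x + y) ω‖₊ * ‖(((l + k) + (l + k) : L0F F P) :
          Ω →ₘ[P] ℝ) ω‖₊⁻¹)) ≤ᵐ[P] (fun ω => φ (‖x ω‖₊ * ‖(l : Ω →ₘ[P] ℝ) ω‖₊⁻¹)) +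
            fun ω => φ (‖y ω‖₊ * ‖(k : Ω →ₘ[P] ℝ) ω‖₊⁻¹) := by
        filter_upwards [hl, hk, e1, e2, AEEqFun.coeFn_add x y] with ω h1 h2 h3 h4 h5
        simp only [Subring.coe_add, h5, h4, h3, Pi.add_apply]
        have hmax : ‖x ω + y ω‖₊ * ‖(l : Ω →ₘ[P] ℝ) ω + (k : Ω →ₘ[P] ℝ) ω +
            ((l : Ω →ₘ[P] ℝ) ω + (k : Ω →ₘ[P] ℝ) ω)‖₊⁻¹ ≤
            max (‖x ω‖₊ * ‖(l : Ω →ₘ[P] ℝ) ω‖₊⁻¹) (‖y ω‖₊ * ‖(k : Ω →ₘ[P] ℝ) ω‖₊⁻¹) := by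
          generalize (l : Ω →ₘ[P] ℝ) ω = p at *
          generalize (k : Ω →ₘ[P] ℝ) ω = q at *
          rw [← NNReal.coe_le_coe, NNReal.coe_max]
          push_cast
          rw [Real.norm_of_nonneg h1.le, Real.norm_of_nonneg h2.le,
            Real.norm_of_nonneg (by positivity : 0 ≤ p + q + (p + q))]
          set M := max (‖x ω‖ * p⁻¹) (‖y ω‖ * q⁻¹)
          have hM1 : ‖x ω‖ ≤ M * p := by
            rw [← div_le_iff₀ h1, div_eq_mul_inv]; exact le_max_left _ _
          have hM2 : ‖y ω‖ ≤ M * q := by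
            rw [← div_le_iff₀ h2, div_eq_mul_inv]; exact le_max_right _ _
          have hM0 : 0 ≤ M := le_trans (by positivity) (le_max_left _ _)
          rw [← div_eq_mul_inv, div_le_iff₀ (by positivity)]
          nlinarith [norm_add_le (x ω) (y ω), mul_nonneg hM0 h1.le, mul_nonneg hM0 h2.le]
        refine (hφ.mono hmax).trans ?_
        rcases max_cases (‖x ω‖₊ * ‖(l : Ω →ₘ[P] ℝ) ω‖₊⁻¹)
          (‖y ω‖₊ * ‖(k : Ω →ₘ[P] ℝ) ω‖₊⁻¹) with h | h
        · rw [h.1]; exact le_self_add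
        · rw [h.1]; exact le_add_self
      filter_upwards [condLExp_mono (mΩ := F) hle, condLExp_add_left (mΩ := F) _ hmeas, hx, hy]
        with ω h1 h2 h3 h4
      exact h1.trans_lt (h2 ▸ ENNReal.add_lt_top.2 ⟨h3, h4⟩)
  smul_mem' := by
    rintro a x ⟨l, hl, hx⟩
    have e1 := AEEqFun.coeFn_mul (l : Ω →ₘ[P] ℝ) (1 + (a : Ω →ₘ[P] ℝ) * a)
    have e2 := AEEqFun.coeFn_add (1 : Ω →ₘ[P] ℝ) ((a : Ω →ₘ[P] ℝ) * a)
    have e3 := AEEqFun.coeFn_mul (a : Ω →ₘ[P] ℝ) a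
    have e4 := AEEqFun.coeFn_one (μ := P) (α := Ω) (β := ℝ)
    refine ⟨l * (1 + a * a), ?_, ?_⟩
    · filter_upwards [hl, e1, e2, e3, e4] with ω h0 h1 h2 h3 h4
      simp only [Subring.coe_mul, Subring.coe_add, Subring.coe_one, h1, h2, h3, h4,
        Pi.add_apply, Pi.mul_apply, Pi.one_apply]
      nlinarith [mul_self_nonneg ((a : Ω →ₘ[P] ℝ) ω)]
    · have hle : (fun ω => φ (‖(a • x) ω‖₊ * ‖((l * (1 + a * a) : L0F F P) :
          Ω →ₘ[P] ℝ) ω‖₊⁻¹)) ≤ᵐ[P] fun ω => φ (‖x ω‖₊ * ‖(l : Ω →ₘ[P] ℝ) ω‖₊⁻¹) := by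
        filter_upwards [hl, e1, e2, e3, e4, AEEqFun.coeFn_mul (a : Ω →ₘ[P] ℝ) x]
          with ω h0 h1 h2 h3 h4 h5
        simp only [Subring.smul_def, smul_eq_mul, Subring.coe_mul, Subring.coe_add,
          Subring.coe_one, h1, h2, h3, h4, h5, Pi.add_apply, Pi.mul_apply, Pi.one_apply]
        apply hφ.mono
        generalize (l : Ω →ₘ[P] ℝ) ω = p at *
        generalize (a : Ω →ₘ[P] ℝ) ω = q at *
        rw [← NNReal.coe_le_coe]
        push_cast
        have hq : (0 : ℝ) < 1 + q * q := by nlinarith [mul_self_nonneg q]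
        rw [norm_mul, norm_mul, Real.norm_of_nonneg h0.le, Real.norm_of_nonneg hq.le,
          ← div_eq_mul_inv, ← div_eq_mul_inv, div_le_div_iff₀ (by positivity) h0]
        have hq' : ‖q‖ ≤ 1 + q * q := by
          rw [Real.norm_eq_abs]; nlinarith [sq_abs q, sq_nonneg (|q| - 1)]
        have := mul_le_mul_of_nonneg_right hq' (mul_nonneg (norm_nonneg (x ω)) h0.le)
        linarith
      filter_upwards [condLExp_mono (mΩ := F) hle, hx] with ω h1 h2
      exact h1.trans_lt h2

/-! ### Conditionally linear functionals and order continuity -/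

section Functionals

variable {F P} (hF : F ≤ mΩ) (hφ : IsYoung φ)

/-- Conditionally linear functions `L^φ → R`: stable homomorphisms of `L⁰(F)`-modules. -/
def IsCondLinear (f : orlicz F P hφ → L0F F P) : Prop :=
  IsStable P hF f ∧ IsLinearMap (L0F F P) f

/-- Conditional order boundedness: `f([-|x|, |x|]) ⊆ [-y, y]` for some `y ∈ L⁰₊(F)`. -/
def IsOrderBounded (f : orlicz F P hφ → L0F F P) : Prop :=
  ∀ x : orlicz F P hφ, ∃ y : L0F F P, (0 : Ω →ₘ[P] ℝ) ≤ y ∧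
    ∀ z : orlicz F P hφ, (z : Ω →ₘ[P] ℝ) ∈ Icc (-|(x : Ω →ₘ[P] ℝ)|) |(x : Ω →ₘ[P] ℝ)| →
      (f z : Ω →ₘ[P] ℝ) ∈ Icc (-(y : Ω →ₘ[P] ℝ)) y

/-- Conditional order continuity: order boundedness, and `inf_{x ∈ D} |f(x)| = 0` for every
conditionally downward directed conditional subset of `L^φ` (generated by a non-empty downward
directed set `D` with the countable concatenation property) with `inf D = 0`. -/
def IsCondOrderContinuous (f : orlicz F P hφ → L0F F P) : Prop :=
  IsOrderBounded hφ f ∧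
    ∀ D : Set (orlicz F P hφ), D.Nonempty → HasCCP P hF D →
      DirectedOn (fun x y : orlicz F P hφ => (y : Ω →ₘ[P] ℝ) ≤ x) D →
      IsGLB ((fun x : orlicz F P hφ => (x : Ω →ₘ[P] ℝ)) '' D) 0 →
      IsGLB ((fun x : orlicz F P hφ => |(f x : Ω →ₘ[P] ℝ)|) '' D) 0

/-- The set of conditionally order continuous, conditionally linear functions `L^φ → R`. -/
def orderDual : Set (orlicz F P hφ → L0F F P) :=
  {f | IsCondLinear hF hφ f ∧ IsCondOrderContinuous hF hφ f}

variable (F P) in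
/-- The function `μ_y : x ↦ E[x y | F]` on `L^φ_F(mΩ)`. -/
def muFun (y : Ω →ₘ[P] ℝ) : orlicz F P hφ → L0F F P :=
  fun x => condE F P ((x : Ω →ₘ[P] ℝ) * y)

end Functionals

end CondOrlicz

end

/-! Everything conditional is reduced to ordinary integration by weights, that is, everywhere
positive `F`-measurable functions `w`. An element `x` lies in `L1F` exactly when `w x` is integrable
for some weight, and then `E[x | F]` is `E[w x | F] / w`. With this, Young's inequality gives `x y ∈
L¹_F`, and each `μ_y` is order continuous by dominated convergence, since a downward directed set
with infimum `0` contains a sequence decreasing to `0` almost surely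
(`exists_antitone_tendsto_zero`).

Conversely, let `f` be order continuous. Order boundedness yields a weight with `|w f(1_A)| ≤ 1` for
all `A`, and `ν(A) = ∫ w f(1_A)` is finitely additive. Order continuity speaks only of sets closed
under concatenation, so a sequence `d n ↓ 0` has to be enlarged to all `d_N` with `N` an
`F`-measurable random index (`exists_randomIndex_tendsto_zero`). As `f` is not assumed positive,
smallness of `ν` along random indices does not give σ-additivity at once; a nearly maximising set
for `ν` provides it (`exists_forall_subset_le`). Radon–Nikodym then gives a density `g`, and `y = g
/ w` represents `f` on indicators, hence on simple functions.

Order boundedness forces `x y ∈ L¹_F` for every `x ∈ L^φ` (`mul_mem_L1F_of_eq_muFun`), and a second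
use of random indices extends `f = μ_y` to all `x` (`eq_muFun_of_nonneg`). That `y` belongs to
`L^{φ*}` is a gliding hump argument (`ae_exists_condLExp_conj_lt_top`): otherwise some `x ∈ L^φ` has
`E[|x y| | F] = ∞` with positive probability. Injectivity comes from testing on indicators, and the
equality of conditional sets holds because the `μ_y` are already closed under concatenation. -/

noncomputable section

namespace CondOrlicz

/-! ### Weights -/

section Weights

variable {Ω : Type*} {F : MeasurableSpace Ω}

/-- A weight is an everywhere positive `F`-measurable function. -/
structure IsWeight (F : MeasurableSpace Ω) (w : Ω → ℝ≥0) : Prop where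
  meas : Measurable[F] w
  pos : ∀ ω, 0 < w ω

lemma IsWeight.min {w v : Ω → ℝ≥0} (hw : IsWeight F w) (hv : IsWeight F v) :
    IsWeight F (fun ω => min (w ω) (v ω)) :=
  ⟨hw.meas.min hv.meas, fun ω => lt_min (hw.pos ω) (hv.pos ω)⟩

lemma IsWeight.mul {w v : Ω → ℝ≥0} (hw : IsWeight F w) (hv : IsWeight F v) :
    IsWeight F (fun ω => w ω * v ω) :=
  ⟨hw.meas.mul hv.meas, fun ω => mul_pos (hw.pos ω) (hv.pos ω)⟩

lemma IsWeight.inv_one_add {a : Ω → ℝ≥0} (ha : Measurable[F] a) :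
    IsWeight F (fun ω => (1 + a ω)⁻¹) :=
  ⟨(measurable_const.add ha).inv, fun ω => by positivity⟩

end Weights

variable {Ω : Type*} {F : MeasurableSpace Ω} [mΩ : MeasurableSpace Ω] {P : Measure Ω}

/-! ### The conditional Lebesgue expectation -/

/-- The measures with densities `g` and `E[g | F]` coincide on `F`, so they integrate every
`F`-measurable `c` alike. -/
lemma lintegral_mul_condLExp [IsFiniteMeasure P] (hF : F ≤ mΩ) {c g : Ω → ℝ≥0∞}
    (hc : Measurable[F] c) (hg : AEMeasurable g P) :
    ∫⁻ ω, condLExp F P g ω * c ω ∂P = ∫⁻ ω, g ω * c ω ∂P := by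
  have hc' : Measurable c := hc.mono hF le_rfl
  have key : (P.withDensity (condLExp F P g)).trim hF = (P.withDensity g).trim hF := by
    refine @Measure.ext _ F _ _ fun s hs => ?_
    rw [trim_measurableSet_eq hF hs, trim_measurableSet_eq hF hs, withDensity_apply _ (hF s hs),
      withDensity_apply _ (hF s hs), setLIntegral_condLExp hF P g hs]
  have h1 := lintegral_withDensity_eq_lintegral_mul₀ (μ := P) hg hc'.aemeasurable
  have h2 := lintegral_withDensity_eq_lintegral_mul₀ (μ := P)
    (measurable_condLExp' F P g).aemeasurable hc'.aemeasurable
  simp only [Pi.mul_apply] at h1 h2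
  rw [← h1, ← h2, ← lintegral_trim hF hc, ← lintegral_trim hF hc, key]

lemma condLExp_mul_right [IsFiniteMeasure P] (hF : F ≤ mΩ) {c g : Ω → ℝ≥0∞}
    (hc : Measurable[F] c) (hg : AEMeasurable g P) :
    condLExp F P (fun ω => g ω * c ω) =ᵐ[P] fun ω => condLExp F P g ω * c ω := by
  refine (ae_eq_condLExp hF P _ ((measurable_condLExp F P g).mul hc) fun s hs => ?_).symm
  have e := lintegral_mul_condLExp hF (hc.indicator hs) hg
  simp only [← indicator_mul_right] at e
  rwa [lintegral_indicator (hF s hs), lintegral_indicator (hF s hs)] at e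

lemma condLExp_iSup [IsFiniteMeasure P] (hF : F ≤ mΩ) {g : ℕ → Ω → ℝ≥0∞}
    (hg : ∀ n, Measurable (g n)) (hmono : Monotone g) :
    condLExp F P (fun ω => ⨆ n, g n ω) =ᵐ[P] fun ω => ⨆ n, condLExp F P (g n) ω := by
  refine (ae_eq_condLExp hF P _ (.iSup fun n => measurable_condLExp F P (g n))
    fun s hs => ?_).symm
  rw [lintegral_iSup hg hmono, lintegral_iSup' (fun n => (measurable_condLExp' F P _).aemeasurable)]
  · simp only [setLIntegral_condLExp hF P _ hs]
  · refine ae_restrict_of_ae ?_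
    have : ∀ n, condLExp F P (g n) ≤ᵐ[P] condLExp F P (g (n + 1)) := fun n =>
      condLExp_mono (ae_of_all _ (hmono n.le_succ))
    filter_upwards [ae_all_iff.2 this] with ω hω
    exact monotone_nat_of_le_succ hω

lemma IsWeight.measurable {w : Ω → ℝ≥0} (hw : IsWeight F w) (hF : F ≤ mΩ) : Measurable w :=
  hw.meas.mono hF le_rfl

/-- Dividing by `1 + E[g | F]` bounds the integral by the total mass. Conversely, a finite integral
of `E[g | F] w` excludes the value `∞`, because `w` vanishes nowhere. -/
lemma condLExp_lt_top_iff [IsFiniteMeasure P] (hF : F ≤ mΩ) {g : Ω → ℝ≥0∞}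
    (hg : AEMeasurable g P) : (∀ᵐ ω ∂P, condLExp F P g ω < ∞) ↔
      ∃ w, IsWeight F w ∧ ∫⁻ ω, g ω * w ω ∂P < ∞ := by
  constructor
  · intro h
    -- `toNNReal` sends `∞` to `0`, so the weight is positive everywhere; by `h` this alters only a
    -- null set.
    have hw := IsWeight.inv_one_add (F := F) (measurable_condLExp F P g).ennreal_toNNReal
    refine ⟨_, hw, ?_⟩
    rw [← lintegral_mul_condLExp hF hw.meas.coe_nnreal_ennreal hg]
    refine lt_of_le_of_lt (lintegral_mono_ae (g := fun _ => 1) ?_) (by simp)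
    filter_upwards [h] with ω hω
    generalize condLExp F P g ω = t at *
    lift t to ℝ≥0 using hω.ne
    norm_cast
    rw [← div_eq_mul_inv]
    exact div_le_one_of_le₀ le_add_self (by positivity)
  · rintro ⟨w, hw, h⟩
    rw [← lintegral_mul_condLExp hF hw.meas.coe_nnreal_ennreal hg] at h
    have := ae_lt_top' ((measurable_condLExp' F P g).aemeasurable.mul
      (hw.measurable hF).coe_nnreal_ennreal.aemeasurable) h.ne
    filter_upwards [this] with ω hω
    by_contra hcon
    simp only [not_lt, top_le_iff] at hcon
    simp [hcon, ENNReal.top_mul, (hw.pos ω).ne'] at hω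

lemma condLExp_eqOn [IsFiniteMeasure P] (hF : F ≤ mΩ) {g g' : Ω → ℝ≥0∞}
    (hg : AEMeasurable g P) (hg' : AEMeasurable g' P) {A : Set Ω} (hA : MeasurableSet[F] A)
    (he : ∀ᵐ ω ∂P, ω ∈ A → g ω = g' ω) :
    ∀ᵐ ω ∂P, ω ∈ A → condLExp F P g ω = condLExp F P g' ω := by
  have hm : Measurable[F] (A.indicator (fun _ => (1 : ℝ≥0∞))) := measurable_const.indicator hA
  have e : (fun ω => g ω * A.indicator (fun _ => (1 : ℝ≥0∞)) ω) =ᵐ[P]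
      fun ω => g' ω * A.indicator (fun _ => (1 : ℝ≥0∞)) ω := by
    filter_upwards [he] with ω h
    by_cases hω : ω ∈ A <;> simp [hω, h]
  filter_upwards [condLExp_mul_right hF hm hg, condLExp_mul_right hF hm hg',
    condLExp_congr_ae (mΩ := F) e] with ω h1 h2 h3 hω
  simpa [hω, h3] using h1.symm.trans (h3.trans h2)

/-! ### The extended conditional expectation through weights -/

/-- From here on a single weight replaces the countable partitions in the definition of the extended
conditional expectation. -/
lemma mem_L1F_iff [IsFiniteMeasure P] (hF : F ≤ mΩ) {x : Ω →ₘ[P] ℝ} :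
    x ∈ L1F F P ↔ ∃ w, IsWeight F w ∧ Integrable (fun ω => (w ω : ℝ) * x ω) P := by
  rw [L1F, mem_ofPred_eq, condLExp_lt_top_iff hF x.measurable.enorm.aemeasurable]
  refine exists_congr fun w => and_congr_right fun hw => ?_
  have hm : Measurable fun ω => (w ω : ℝ) * x ω :=
    (hw.measurable hF).coe_nnreal_real.mul x.measurable
  rw [Integrable, and_iff_right hm.aestronglyMeasurable, HasFiniteIntegral]
  refine Eq.to_iff (congrArg (· < ∞) (lintegral_congr fun ω => ?_))
  rw [enorm_mul, mul_comm]
  simp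

lemma IsWeight.integrable_of_le {w v : Ω → ℝ≥0} (hw : IsWeight F w) (hF : F ≤ mΩ)
    {x y : Ω →ₘ[P] ℝ} (hy : Integrable (fun ω => (v ω : ℝ) * y ω) P) (hwv : ∀ ω, w ω ≤ v ω)
    (hxy : ∀ᵐ ω ∂P, |x ω| ≤ |y ω|) :
    Integrable (fun ω => (w ω : ℝ) * x ω) P := by
  refine hy.mono ((hw.measurable hF).coe_nnreal_real.mul x.measurable).aestronglyMeasurable ?_
  filter_upwards [hxy] with ω h
  rw [norm_mul, norm_mul, Real.norm_eq_abs (x ω), Real.norm_eq_abs (y ω)]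
  exact mul_le_mul (by simpa using hwv ω) h (abs_nonneg _) (norm_nonneg _)

lemma L1F_of_abs_le [IsFiniteMeasure P] (hF : F ≤ mΩ) {x y : Ω →ₘ[P] ℝ} (hy : y ∈ L1F F P)
    (hxy : ∀ᵐ ω ∂P, |x ω| ≤ |y ω|) : x ∈ L1F F P := by
  rw [mem_L1F_iff hF] at hy ⊢
  obtain ⟨w, hw, h⟩ := hy
  exact ⟨w, hw, hw.integrable_of_le hF h (fun _ => le_rfl) hxy⟩

lemma exists_common_weight [IsFiniteMeasure P] (hF : F ≤ mΩ) {x y : Ω →ₘ[P] ℝ}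
    (hx : x ∈ L1F F P) (hy : y ∈ L1F F P) : ∃ w, IsWeight F w ∧
      Integrable (fun ω => (w ω : ℝ) * x ω) P ∧ Integrable (fun ω => (w ω : ℝ) * y ω) P := by
  obtain ⟨w, hw, h⟩ := (mem_L1F_iff hF).1 hx
  obtain ⟨v, hv, h'⟩ := (mem_L1F_iff hF).1 hy
  exact ⟨_, hw.min hv,
    (hw.min hv).integrable_of_le hF h (fun _ => min_le_left _ _) (ae_of_all _ fun _ => le_rfl),
    (hw.min hv).integrable_of_le hF h' (fun _ => min_le_right _ _) (ae_of_all _ fun _ => le_rfl)⟩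

/-- The element of `L⁰(F)` given by an `F`-measurable function. -/
def toL0F (hF : F ≤ mΩ) (f : Ω → ℝ) (hf : Measurable[F] f) : L0F F P :=
  ⟨AEEqFun.mk f (hf.mono hF le_rfl).aestronglyMeasurable,
    hf.stronglyMeasurable.aestronglyMeasurable.congr (AEEqFun.coeFn_mk _ _).symm⟩

lemma coeFn_toL0F (hF : F ≤ mΩ) (f : Ω → ℝ) (hf : Measurable[F] f) :
    ((toL0F hF f hf : L0F F P) : Ω →ₘ[P] ℝ) =ᵐ[P] f := AEEqFun.coeFn_mk _ _

lemma exists_measurable_rep (a : L0F F P) :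
    ∃ f : Ω → ℝ, Measurable[F] f ∧ (a : Ω →ₘ[P] ℝ) =ᵐ[P] f :=
  ⟨_, (AEStronglyMeasurable.stronglyMeasurable_mk a.2).measurable,
    AEStronglyMeasurable.ae_eq_mk a.2⟩

lemma L0F_ext {a b : L0F F P} (h : (a : Ω →ₘ[P] ℝ) =ᵐ[P] (b : Ω →ₘ[P] ℝ)) : a = b :=
  Subtype.ext (AEEqFun.ext h)

/-- The partition is given by the level sets of `⌊1 / w⌋`. On the `k`-th one `1 / w` is at most `k +
1`, so `1_{A_k} x` is the integrable `w x` times a bounded `F`-measurable factor, which can be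
pulled out. -/
lemma isCondExp_of_weight (hF : F ≤ mΩ) {x : Ω →ₘ[P] ℝ} {w : Ω → ℝ≥0}
    (hw : IsWeight F w) (hx : Integrable (fun ω => (w ω : ℝ) * x ω) P) {z : L0F F P}
    (hz : (fun ω => (w ω : ℝ) * (z : Ω →ₘ[P] ℝ) ω) =ᵐ[P] P[fun ω => (w ω : ℝ) * x ω | F]) :
    IsCondExp F P x z := by
  have hfl : Measurable[F] fun ω => ⌊(w ω)⁻¹⌋₊ := Nat.measurable_floor.comp hw.meas.inv
  let A : ℕ → FSet F := fun k => ⟨{ω | ⌊(w ω)⁻¹⌋₊ = k}, hfl (measurableSet_singleton k)⟩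
  have hAdef : ∀ k ω, ω ∈ (A k).1 ↔ ⌊(w ω)⁻¹⌋₊ = k := fun k ω => Iff.rfl
  refine ⟨A, ⟨?_, ?_⟩, fun k => ((ind P hF (A k) : L0F F P) : Ω →ₘ[P] ℝ) * x, fun k => ?_⟩
  · intro i j hij
    refine disjoint_left.2 fun ω h1 h2 => hij ?_
    rw [hAdef] at h1 h2
    omega
  · exact eq_univ_of_forall fun ω => mem_iUnion.2 ⟨_, (hAdef _ _).2 rfl⟩
  have e0 : (((ind P hF (A k) : L0F F P) : Ω →ₘ[P] ℝ) * x : Ω →ₘ[P] ℝ) =ᵐ[P]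
      fun ω => (A k).1.indicator (fun _ => (1 : ℝ)) ω * x ω := by
    filter_upwards [AEEqFun.coeFn_mul ((ind P hF (A k) : L0F F P) : Ω →ₘ[P] ℝ) x,
      AEEqFun.coeFn_mk ((A k).1.indicator fun _ => (1 : ℝ))
        ((aestronglyMeasurable_const (μ := P)).indicator (hF _ (A k).2))] with ω h1 h2
    rw [h1, Pi.mul_apply]
    exact congrArg (· * x ω) h2
  let c : Ω → ℝ := (A k).1.indicator (fun ω => ((w ω : ℝ))⁻¹)
  have hc : Measurable[F] c := (hw.meas.coe_nnreal_real.inv).indicator (A k).2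
  have e1 : (((ind P hF (A k) : L0F F P) : Ω →ₘ[P] ℝ) * x : Ω →ₘ[P] ℝ) =ᵐ[P]
      c * fun ω => (w ω : ℝ) * x ω := by
    filter_upwards [e0] with ω h
    rw [h, Pi.mul_apply]
    have := (hw.pos ω).ne'
    by_cases hω : ω ∈ (A k).1
    · simp only [c, indicator_of_mem hω]; field_simp
    · simp [c, indicator_of_notMem hω]
  have hcb : ∀ ω, ‖c ω‖ ≤ k + 1 := fun ω => by
    by_cases hω : ω ∈ (A k).1
    · simp only [c, indicator_of_mem hω]
      have := Nat.lt_floor_add_one ((w ω)⁻¹)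
      rw [(hAdef _ _).1 hω] at this
      rw [Real.norm_of_nonneg (by positivity)]
      exact_mod_cast this.le
    · simp only [c, indicator_of_notMem hω, norm_zero]; positivity
  have hinteg : Integrable (c * fun ω => (w ω : ℝ) * x ω) P :=
    hx.bdd_mul (hc.mono hF le_rfl).aestronglyMeasurable (ae_of_all _ hcb)
  refine ⟨hinteg.congr e1.symm, ?_, ?_⟩
  · filter_upwards [e0] with ω h hω
    rw [h]; simp [hω]
  · filter_upwards [condExp_congr_ae (m := F) e1,
      condExp_mul_of_stronglyMeasurable_left hc.stronglyMeasurable hinteg hx, hz] with ω h1 h2 h3 hω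
    rw [h1, h2, Pi.mul_apply, ← h3]
    have := (hw.pos ω).ne'
    simp only [c, indicator_of_mem hω]; field_simp

/-- `E[w x | F] / w` is an extended conditional expectation of `x`, and uniqueness identifies it
with `condE`. The properties of `condE` below are read off from `condExp` through this identity. -/
lemma weight_mul_condE [IsFiniteMeasure P] (hF : F ≤ mΩ) {x : Ω →ₘ[P] ℝ} {w : Ω → ℝ≥0}
    (hw : IsWeight F w) (hx : Integrable (fun ω => (w ω : ℝ) * x ω) P) :
    (fun ω => (w ω : ℝ) * (condE F P x : Ω →ₘ[P] ℝ) ω) =ᵐ[P]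
      P[fun ω => (w ω : ℝ) * x ω | F] := by
  have hm : Measurable[F] fun ω => ((w ω : ℝ))⁻¹ * (P[fun ω => (w ω : ℝ) * x ω | F]) ω :=
    hw.meas.coe_nnreal_real.inv.mul stronglyMeasurable_condExp.measurable
  have hz : (fun ω => (w ω : ℝ) * (toL0F (P := P) hF _ hm : Ω →ₘ[P] ℝ) ω) =ᵐ[P]
      P[fun ω => (w ω : ℝ) * x ω | F] := by
    filter_upwards [coeFn_toL0F (P := P) hF _ hm] with ω h
    rw [h, mul_inv_cancel_left₀ (NNReal.coe_ne_zero.2 (hw.pos ω).ne')]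
  have h := isCondExp_of_weight hF hw hx hz
  have hex : ∃ z, IsCondExp F P x z := ⟨_, h⟩
  have : condE F P x = toL0F hF _ hm := by
    rw [condE, dif_pos hex]
    exact hex.choose_spec.unique h
  rw [this]
  exact hz

lemma condE_eq_of_weight [IsFiniteMeasure P] (hF : F ≤ mΩ) {x : Ω →ₘ[P] ℝ} {w : Ω → ℝ≥0}
    (hw : IsWeight F w) (hx : Integrable (fun ω => (w ω : ℝ) * x ω) P) {z : L0F F P}
    (hz : (fun ω => (w ω : ℝ) * (z : Ω →ₘ[P] ℝ) ω) =ᵐ[P] P[fun ω => (w ω : ℝ) * x ω | F]) :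
    condE F P x = z := by
  refine L0F_ext ?_
  filter_upwards [weight_mul_condE hF hw hx, hz] with ω h1 h2
  exact mul_left_cancel₀ (NNReal.coe_ne_zero.2 (hw.pos ω).ne') (h1.trans h2.symm)

lemma condE_add [IsFiniteMeasure P] (hF : F ≤ mΩ) {x y : Ω →ₘ[P] ℝ} (hx : x ∈ L1F F P)
    (hy : y ∈ L1F F P) : condE F P (x + y) = condE F P x + condE F P y := by
  obtain ⟨w, hw, h, h'⟩ := exists_common_weight hF hx hy
  have e : (fun ω => (w ω : ℝ) * (x + y) ω) =ᵐ[P]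
      (fun ω => (w ω : ℝ) * x ω) + fun ω => (w ω : ℝ) * y ω := by
    filter_upwards [AEEqFun.coeFn_add x y] with ω h1
    rw [h1, Pi.add_apply, Pi.add_apply, mul_add]
  refine condE_eq_of_weight hF hw ((h.add h').congr e.symm) ?_
  filter_upwards [weight_mul_condE hF hw h, weight_mul_condE hF hw h', condExp_congr_ae (m := F) e,
    condExp_add h h' F, AEEqFun.coeFn_add (condE F P x : Ω →ₘ[P] ℝ) (condE F P y)]
    with ω h1 h2 h3 h4 h5
  rw [Subring.coe_add, h5, h3, h4, Pi.add_apply, Pi.add_apply, mul_add, h1, h2]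

lemma condE_mul [IsFiniteMeasure P] (hF : F ≤ mΩ) {x : Ω →ₘ[P] ℝ} (hx : x ∈ L1F F P)
    (a : L0F F P) : condE F P ((a : Ω →ₘ[P] ℝ) * x) = a * condE F P x := by
  obtain ⟨w, hw, h⟩ := (mem_L1F_iff hF).1 hx
  obtain ⟨b, hb, hab⟩ := exists_measurable_rep a
  -- The extra factor absorbs `b`, so one weight serves both `x` and `a x`.
  have hv : IsWeight F fun ω => w ω * (1 + ‖b ω‖₊)⁻¹ :=
    hw.mul (IsWeight.inv_one_add (measurable_nnnorm.comp hb))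
  have hvw : ∀ ω, w ω * (1 + ‖b ω‖₊)⁻¹ ≤ w ω := fun ω =>
    mul_le_of_le_one_right' (inv_le_one_of_one_le₀ le_self_add)
  have hvx := hv.integrable_of_le hF h hvw (ae_of_all _ fun _ => le_rfl)
  have e : (fun ω => ((w ω * (1 + ‖b ω‖₊)⁻¹ : ℝ≥0) : ℝ) * ((a : Ω →ₘ[P] ℝ) * x) ω) =ᵐ[P]
      b * fun ω => ((w ω * (1 + ‖b ω‖₊)⁻¹ : ℝ≥0) : ℝ) * x ω := by
    filter_upwards [AEEqFun.coeFn_mul (a : Ω →ₘ[P] ℝ) x, hab] with ω h1 h2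
    rw [h1, Pi.mul_apply, Pi.mul_apply, h2]
    ring
  have hi : Integrable (b * fun ω => ((w ω * (1 + ‖b ω‖₊)⁻¹ : ℝ≥0) : ℝ) * x ω) P := by
    refine h.mono ((hb.mono hF le_rfl).mul ((hv.measurable hF).coe_nnreal_real.mul
      x.measurable)).aestronglyMeasurable (ae_of_all _ fun ω => ?_)
    have h1 : ‖b ω‖ * (1 + ‖b ω‖)⁻¹ ≤ 1 := by
      rw [← div_eq_mul_inv]
      exact div_le_one_of_le₀ (by linarith) (by positivity)
    simp only [Pi.mul_apply, norm_mul, NNReal.coe_mul, NNReal.coe_inv, NNReal.coe_add,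
      NNReal.coe_one, coe_nnnorm, norm_inv, NNReal.norm_eq]
    rw [Real.norm_of_nonneg (by positivity : 0 ≤ 1 + ‖b ω‖)]
    calc ‖b ω‖ * (w ω * (1 + ‖b ω‖)⁻¹ * ‖x ω‖)
        = (‖b ω‖ * (1 + ‖b ω‖)⁻¹) * (w ω * ‖x ω‖) := by ring
      _ ≤ 1 * (w ω * ‖x ω‖) := by gcongr
      _ = _ := one_mul _
  refine condE_eq_of_weight hF hv (hi.congr e.symm) ?_
  filter_upwards [weight_mul_condE hF hv hvx, condExp_congr_ae (m := F) e, hab,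
    condExp_mul_of_stronglyMeasurable_left hb.stronglyMeasurable hi hvx,
    AEEqFun.coeFn_mul (a : Ω →ₘ[P] ℝ) (condE F P x)] with ω h1 h2 h3 h4 h5
  rw [Subring.coe_mul, h5, h2, h4, Pi.mul_apply, Pi.mul_apply, ← h1, h3]
  ring

lemma abs_condE_le [IsFiniteMeasure P] (hF : F ≤ mΩ) {x y : Ω →ₘ[P] ℝ} (hy : y ∈ L1F F P)
    (hxy : ∀ᵐ ω ∂P, |x ω| ≤ y ω) :
    ∀ᵐ ω ∂P, |(condE F P x : Ω →ₘ[P] ℝ) ω| ≤ (condE F P y : Ω →ₘ[P] ℝ) ω := by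
  obtain ⟨w, hw, h⟩ := (mem_L1F_iff hF).1 hy
  have hx := hw.integrable_of_le hF h (fun _ => le_rfl)
    (hxy.mono fun ω hω => hω.trans (le_abs_self _))
  have hle : |fun ω => (w ω : ℝ) * x ω| ≤ᵐ[P] fun ω => (w ω : ℝ) * y ω := by
    filter_upwards [hxy] with ω h1
    simp only [Pi.abs_apply, abs_mul, NNReal.abs_eq]
    gcongr
  filter_upwards [weight_mul_condE hF hw h, weight_mul_condE hF hw hx,
    abs_condExp_ae_le_condExp_abs (m := F) (μ := P) fun ω => (w ω : ℝ) * x ω,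
    condExp_mono (m := F) hx.abs h hle] with ω h1 h2 h3 h4
  have := h3.trans h4
  rw [← h1, Pi.abs_apply, ← h2, abs_mul, NNReal.abs_eq] at this
  exact le_of_mul_le_mul_left this (NNReal.coe_pos.2 (hw.pos ω))

lemma integral_weight_mul_condE [IsFiniteMeasure P] (hF : F ≤ mΩ) {x : Ω →ₘ[P] ℝ} {w : Ω → ℝ≥0}
    (hw : IsWeight F w) (hx : Integrable (fun ω => (w ω : ℝ) * x ω) P) :
    ∫ ω, (w ω : ℝ) * (condE F P x : Ω →ₘ[P] ℝ) ω ∂P = ∫ ω, (w ω : ℝ) * x ω ∂P := by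
  rw [integral_congr_ae (weight_mul_condE hF hw hx), integral_condExp hF]

end CondOrlicz

end

noncomputable section

namespace CondOrlicz

variable {Ω : Type*} {F : MeasurableSpace Ω} [mΩ : MeasurableSpace Ω] {P : Measure Ω}
  {φ : ℝ≥0 → ℝ≥0∞}

/-! ### Elements of the Orlicz-type module -/

lemma mem_orlicz_of_abs_le (hφ : IsYoung φ) {x y : Ω →ₘ[P] ℝ} (hy : y ∈ orlicz F P hφ)
    (hxy : ∀ᵐ ω ∂P, |x ω| ≤ |y ω|) : x ∈ orlicz F P hφ := by
  obtain ⟨l, hl, h⟩ := hy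
  refine ⟨l, hl, ?_⟩
  have hle : (fun ω => φ (‖x ω‖₊ * ‖(l : Ω →ₘ[P] ℝ) ω‖₊⁻¹)) ≤ᵐ[P]
      fun ω => φ (‖y ω‖₊ * ‖(l : Ω →ₘ[P] ℝ) ω‖₊⁻¹) := by
    filter_upwards [hxy] with ω h1
    refine hφ.mono (mul_le_mul_left ?_ _)
    exact h1
  filter_upwards [condLExp_mono (mΩ := F) hle, h] with ω h1 h2
  exact h1.trans_lt h2

lemma IsYoung.exists_pos_lt_top (hφ : IsYoung φ) : ∃ t : ℝ≥0, 0 < t ∧ φ t < ∞ := by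
  have h : ∀ᶠ t in 𝓝[>] (0 : ℝ≥0), φ t < ∞ := hφ.finite_near_zero.filter_mono nhdsWithin_le_nhds
  obtain ⟨t, h1, h2⟩ := (h.and self_mem_nhdsWithin).exists
  exact ⟨t, h2, h1⟩

lemma mem_orlicz_of_bounded [IsFiniteMeasure P] (hF : F ≤ mΩ) (hφ : IsYoung φ) {x : Ω →ₘ[P] ℝ}
    (C : ℝ≥0) (hx : ∀ᵐ ω ∂P, |x ω| ≤ C) : x ∈ orlicz F P hφ := by
  obtain ⟨t, ht, hφt⟩ := hφ.exists_pos_lt_top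
  -- With the scale `(C + 1) / t` the argument of `φ` stays below `t`, where `φ` is finite; the `+
  -- 1` keeps the scale positive when `C = 0`.
  have hpos : (0 : ℝ) < (((C + 1) / t : ℝ≥0) : ℝ) := by positivity
  have hl := coeFn_toL0F (P := P) hF (fun _ => (((C + 1) / t : ℝ≥0) : ℝ)) measurable_const
  refine ⟨toL0F hF (fun _ => (((C + 1) / t : ℝ≥0) : ℝ)) measurable_const, ?_, ?_⟩
  · filter_upwards [hl] with ω h
    rw [h]; exact hpos
  · refine condLExp_lt_top (ne_top_of_le_ne_top (b := ∫⁻ _, φ t ∂P) ?_ (lintegral_mono_ae ?_))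
    · rw [lintegral_const]
      exact ENNReal.mul_ne_top hφt.ne (measure_ne_top _ _)
    · filter_upwards [hl, hx] with ω h1 h2
      rw [h1]
      refine hφ.mono ?_
      rw [NNReal.nnnorm_eq, ← div_eq_mul_inv]
      refine div_le_of_le_mul₀ (by positivity) (by positivity) ?_
      rw [mul_div_cancel₀ _ ht.ne']
      exact (show ‖x ω‖₊ ≤ C from h2).trans (by simp)

/-- Young's inequality. -/
lemma coe_mul_le_add_conj (φ : ℝ≥0 → ℝ≥0∞) (t s : ℝ≥0) :
    ((t * s : ℝ≥0) : ℝ≥0∞) ≤ φ t + conj φ s :=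
  tsub_le_iff_left.1 (le_iSup (fun t : ℝ≥0 => ((t * s : ℝ≥0) : ℝ≥0∞) - φ t) t)

lemma conj_mono (φ : ℝ≥0 → ℝ≥0∞) : Monotone (conj φ) := fun _ _ h =>
  iSup_mono fun t => tsub_le_tsub_right (ENNReal.coe_le_coe.2 (mul_le_mul_right h t)) _

lemma measurable_comp_div {ψ : ℝ≥0 → ℝ≥0∞} (hψ : Monotone ψ) (x l : Ω →ₘ[P] ℝ) :
    Measurable fun ω => ψ (‖x ω‖₊ * ‖l ω‖₊⁻¹) :=
  hψ.measurable.comp (x.measurable.nnnorm.mul l.measurable.nnnorm.inv)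

/-- An element of the Orlicz-type set in terms of a weight `w` and a positive `F`-measurable
function `l`. -/
lemma exists_weight_of_mem_orliczSet [IsFiniteMeasure P] (hF : F ≤ mΩ) {ψ : ℝ≥0 → ℝ≥0∞}
    (hψ : Monotone ψ) {x : Ω →ₘ[P] ℝ} (hx : x ∈ orliczSet F P ψ) :
    ∃ w v, IsWeight F w ∧ IsWeight F v ∧ ∫⁻ ω, ψ (‖x ω‖₊ * v ω) * w ω ∂P < ∞ := by
  obtain ⟨l, hl, h⟩ := hx
  obtain ⟨w, hw, hwi⟩ := (condLExp_lt_top_iff hF (measurable_comp_div hψ x l).aemeasurable).1 h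
  obtain ⟨b, hb, hlb⟩ := exists_measurable_rep l
  -- The representative `b` of the scale is positive only almost surely; the value `1` on the
  -- exceptional set makes `v` a weight.
  have hv : IsWeight F fun ω => if 0 < b ω then ‖b ω‖₊⁻¹ else 1 := by
    refine ⟨Measurable.ite (hb measurableSet_Ioi)
      (measurable_nnnorm.comp hb).inv measurable_const, fun ω => ?_⟩
    split_ifs with h0
    · exact inv_pos.2 (nnnorm_pos.2 h0.ne')
    · exact one_pos
  refine ⟨w, _, hw, hv, lt_of_le_of_lt (lintegral_mono_ae ?_) hwi⟩
  filter_upwards [hl, hlb] with ω h1 h2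
  rw [h2] at h1 ⊢
  simp [h1]

/-- Young's inequality for `|x| v` and `|y| v'` shows that `min w w' * (v * v')` is a weight making
`x y` integrable. -/
lemma mul_mem_L1F [IsFiniteMeasure P] (hF : F ≤ mΩ) (hφ : IsYoung φ) {x y : Ω →ₘ[P] ℝ}
    (hx : x ∈ orlicz F P hφ) (hy : y ∈ orliczSet F P (conj φ)) : x * y ∈ L1F F P := by
  obtain ⟨w, v, hw, hv, h⟩ := exists_weight_of_mem_orliczSet hF hφ.mono hx
  obtain ⟨w', v', hw', hv', hyi⟩ := exists_weight_of_mem_orliczSet hF (conj_mono φ) hy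
  rw [mem_L1F_iff hF]
  have hW := (hw.min hw').mul (hv.mul hv')
  refine ⟨_, hW, ((hW.measurable hF).coe_nnreal_real.mul
    (x * y).measurable).aestronglyMeasurable, ?_⟩
  refine lt_of_le_of_lt (lintegral_mono_ae (g := fun ω => φ (‖x ω‖₊ * v ω) * w ω +
    conj φ (‖y ω‖₊ * v' ω) * w' ω) ?_) ?_
  · filter_upwards [AEEqFun.coeFn_mul x y] with ω h1
    rw [h1]
    have e : ‖((min (w ω) (w' ω) * (v ω * v' ω) : ℝ≥0) : ℝ) * (⇑x * ⇑y) ω‖ₑ =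
        (((‖x ω‖₊ * v ω) * (‖y ω‖₊ * v' ω) : ℝ≥0) : ℝ≥0∞) * (min (w ω) (w' ω) : ℝ≥0) := by
      rw [enorm_eq_nnnorm, ← ENNReal.coe_mul]
      congr 1
      simp only [Pi.mul_apply, nnnorm_mul, NNReal.nnnorm_eq]
      ring
    rw [e]
    refine (mul_le_mul_left (coe_mul_le_add_conj φ _ _) _).trans ?_
    rw [add_mul]
    gcongr
    · exact min_le_left _ _
    · exact min_le_right _ _
  · have hm : Measurable fun ω => φ (‖x ω‖₊ * v ω) * w ω :=
      (hφ.mono.measurable.comp (x.measurable.nnnorm.mul (hv.measurable hF))).mul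
        (hw.measurable hF).coe_nnreal_ennreal
    rw [lintegral_add_left hm]
    exact ENNReal.add_lt_top.2 ⟨h, hyi⟩

/-! ### Countable attainment of essential infima -/

lemma coeFn_nonneg {a : Ω →ₘ[P] ℝ} (ha : 0 ≤ a) : ∀ᵐ ω ∂P, 0 ≤ a ω := by
  filter_upwards [AEEqFun.coeFn_le.2 ha, AEEqFun.coeFn_zero (μ := P) (α := Ω) (β := ℝ)] with ω h h'
  rwa [h'] at h

/-- Exhaustion: a decreasing sequence in `S` is chosen to minimise the truncated integral `∫ min(a,
1)` over `S`. If `g` is its limit, minimality makes `min(g, 1)` a lower bound of `S`, so it is at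
most `0`, and therefore `g = 0`. -/
lemma exists_antitone_tendsto_zero [IsFiniteMeasure P] {S : Set (Ω →ₘ[P] ℝ)} (hne : S.Nonempty)
    (hdir : ∀ a ∈ S, ∀ b ∈ S, ∃ c ∈ S, c ≤ a ∧ c ≤ b) (hglb : IsGLB S 0) :
    ∃ s : ℕ → Ω →ₘ[P] ℝ, (∀ n, s n ∈ S) ∧ Antitone s ∧
      ∀ᵐ ω ∂P, Tendsto (fun n => s n ω) atTop (𝓝 0) := by
  let I : (Ω →ₘ[P] ℝ) → ℝ := fun a => ∫ ω, min (a ω) 1 ∂P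
  have hnn : ∀ a ∈ S, ∀ᵐ ω ∂P, 0 ≤ a ω := fun a ha => coeFn_nonneg (hglb.1 ha)
  have hinteg : ∀ f : Ω → ℝ, Measurable f → (∀ᵐ ω ∂P, 0 ≤ f ω) →
      Integrable (fun ω => min (f ω) 1) P := fun f hf h0 => by
    refine Integrable.of_bound (hf.min measurable_const).aestronglyMeasurable 1 ?_
    filter_upwards [h0] with ω h
    rw [Real.norm_of_nonneg (le_min h zero_le_one)]
    exact min_le_right _ _
  have hImono : ∀ a ∈ S, ∀ b, a ≤ b → I a ≤ I b := fun a ha b hab => by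
    have hab' := AEEqFun.coeFn_le.2 hab
    refine integral_mono_ae (hinteg _ a.measurable (hnn a ha)) (hinteg _ b.measurable ?_) ?_
    · filter_upwards [hab', hnn a ha] with ω h1 h2 using h2.trans h1
    · filter_upwards [hab'] with ω h1 using min_le_min_right _ h1
  have hbdd : BddBelow (I '' S) := ⟨0, by
    rintro _ ⟨a, ha, rfl⟩
    refine integral_nonneg_of_ae ?_
    filter_upwards [hnn a ha] with ω h using le_min h zero_le_one⟩
  set c := sInf (I '' S)
  have hc : ∀ a ∈ S, c ≤ I a := fun a ha => csInf_le hbdd ⟨a, ha, rfl⟩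
  have hex : ∀ n : ℕ, ∃ a ∈ S, I a < c + 1 / (n + 1) := fun n => by
    obtain ⟨_, ⟨a, ha, rfl⟩, h⟩ := exists_lt_of_csInf_lt (hne.image I)
      (show sInf (I '' S) < c + 1 / (n + 1) from lt_add_of_pos_right _ (by positivity))
    exact ⟨a, ha, h⟩
  choose e heS heI using hex
  choose! m hmS hml hmr using hdir
  let s : ℕ → Ω →ₘ[P] ℝ := fun n => Nat.rec (e 0) (fun k a => m a (e (k + 1))) n
  have hs : ∀ n, s n ∈ S := fun n => by
    induction n with
    | zero => exact heS 0
    | succ n ih => exact hmS _ ih _ (heS _)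
  have hanti : Antitone s := antitone_nat_of_succ_le fun n => hml _ (hs n) _ (heS _)
  have hse : ∀ n, s n ≤ e n := fun n => by
    cases n with
    | zero => exact le_rfl
    | succ n => exact hmr _ (hs n) _ (heS _)
  have hlim : Tendsto (fun n => I (s n)) atTop (𝓝 c) := by
    refine tendsto_of_tendsto_of_tendsto_of_le_of_le tendsto_const_nhds
      (h := fun n : ℕ => c + 1 / ((n : ℝ) + 1)) ?_ (fun n => hc _ (hs n))
      (fun n => (hImono _ (hs n) _ (hse n)).trans (heI n).le)
    simpa using (tendsto_one_div_add_atTop_nhds_zero_nat (𝕜 := ℝ)).const_add c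
  let g : Ω → ℝ := fun ω => ⨅ n, s n ω
  have hg : Measurable g := .iInf fun n => (s n).measurable
  have hall : ∀ᵐ ω ∂P, ∀ n, 0 ≤ s n ω := ae_all_iff.2 fun n => hnn _ (hs n)
  have hsg : ∀ᵐ ω ∂P, Tendsto (fun n => s n ω) atTop (𝓝 (g ω)) := by
    have h1 : ∀ᵐ ω ∂P, ∀ n, s (n + 1) ω ≤ s n ω :=
      ae_all_iff.2 fun n => AEEqFun.coeFn_le.2 (hanti n.le_succ)
    filter_upwards [h1, hall] with ω h1 h2
    exact tendsto_atTop_ciInf (antitone_nat_of_succ_le h1) ⟨0, by rintro _ ⟨n, rfl⟩; exact h2 n⟩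
  have hg0 : ∀ᵐ ω ∂P, 0 ≤ g ω := by
    filter_upwards [hall] with ω h using le_ciInf h
  have hdom : ∀ (f : ℕ → Ω → ℝ) (f' : Ω → ℝ), (∀ n, Measurable (f n)) →
      (∀ n, ∀ᵐ ω ∂P, 0 ≤ f n ω) → (∀ᵐ ω ∂P, Tendsto (fun n => f n ω) atTop (𝓝 (f' ω))) →
      Tendsto (fun n => ∫ ω, min (f n ω) 1 ∂P) atTop (𝓝 (∫ ω, min (f' ω) 1 ∂P)) := by
    intro f f' hf hf0 hff
    refine tendsto_integral_of_dominated_convergence (fun _ => 1)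
      (fun n => ((hf n).min measurable_const).aestronglyMeasurable) (integrable_const _)
      (fun n => ?_) ?_
    · filter_upwards [hf0 n] with ω h
      rw [Real.norm_of_nonneg (le_min h zero_le_one)]
      exact min_le_right _ _
    · filter_upwards [hff] with ω h using h.min tendsto_const_nhds
  have hgc : ∫ ω, min (g ω) 1 ∂P = c := tendsto_nhds_unique
    (hdom _ _ (fun n => (s n).measurable) (fun n => hnn _ (hs n)) hsg) hlim
  -- Some element of `S` lies below both `s n` and `d`, so `min(s n, d)` has truncated integral at
  -- least `c`. In the limit `min(g, d)` and `g` have the same truncated integral, hence agree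
  -- almost surely after truncation at `1`.
  have hlow : ∀ d ∈ S, ∀ᵐ ω ∂P, min (g ω) 1 ≤ d ω := by
    intro d hd
    have h1 : c ≤ ∫ ω, min (min (g ω) (d ω)) 1 ∂P := by
      refine ge_of_tendsto' (hdom (fun n ω => min (s n ω) (d ω)) _
        (fun n => (s n).measurable.min d.measurable) (fun n => ?_) ?_) fun n => ?_
      · filter_upwards [hnn _ (hs n), hnn d hd] with ω h h' using le_min h h'
      · filter_upwards [hsg] with ω h using h.min tendsto_const_nhds
      · have hmS' := hmS _ (hs n) _ hd
        refine (hc _ hmS').trans (integral_mono_ae (hinteg _ (m (s n) d).measurable (hnn _ hmS'))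
          (hinteg _ ((s n).measurable.min d.measurable) ?_) ?_)
        · filter_upwards [hnn _ (hs n), hnn d hd] with ω h h' using le_min h h'
        · filter_upwards [AEEqFun.coeFn_le.2 (hml _ (hs n) _ hd),
            AEEqFun.coeFn_le.2 (hmr _ (hs n) _ hd)] with ω h h'
          exact min_le_min_right _ (le_min h h')
    have h2 : (fun ω => min (min (g ω) (d ω)) 1) ≤ᵐ[P] fun ω => min (g ω) 1 :=
      ae_of_all _ fun ω => min_le_min_right _ (min_le_left _ _)
    have i1 : Integrable (fun ω => min (min (g ω) (d ω)) 1) P := by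
      refine hinteg _ (hg.min d.measurable) ?_
      filter_upwards [hg0, hnn d hd] with ω h h' using le_min h h'
    have i2 := hinteg _ hg hg0
    have h3 := (integral_eq_iff_of_ae_le i1 i2 h2).1
      (le_antisymm (integral_mono_ae i1 i2 h2) (hgc ▸ h1))
    filter_upwards [h3] with ω h
    rw [← h]
    exact (min_le_left _ _).trans (min_le_right _ _)
  have hfin := hglb.2 (show AEEqFun.mk (fun ω => min (g ω) 1)
      (hg.min measurable_const).aestronglyMeasurable ∈ lowerBounds S from fun d hd => by
    rw [← AEEqFun.coeFn_le]
    filter_upwards [hlow d hd, AEEqFun.coeFn_mk (fun ω => min (g ω) 1)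
      (hg.min measurable_const).aestronglyMeasurable (μ := P)] with ω h1 h2
    rwa [h2])
  refine ⟨s, hs, hanti, ?_⟩
  filter_upwards [hsg, hg0, AEEqFun.coeFn_le.2 hfin, AEEqFun.coeFn_mk (fun ω => min (g ω) 1)
      (hg.min measurable_const).aestronglyMeasurable (μ := P),
      AEEqFun.coeFn_zero (μ := P) (α := Ω) (β := ℝ)] with ω h1 h2 h3 h4 h5
  rw [h4, h5, Pi.zero_apply, min_le_iff] at h3
  have : g ω = 0 := le_antisymm (h3.resolve_right (by norm_num)) h2
  rwa [this] at h1

end CondOrlicz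

end

noncomputable section

namespace CondOrlicz

lemma abs_indicator_one_le {Ω : Type*} (A : Set Ω) (ω : Ω) :
    |A.indicator (fun _ => (1 : ℝ)) ω| ≤ (1 : ℝ≥0) := by
  by_cases h : ω ∈ A <;> simp [h]

/-- Countable concatenation of functions along a partition. -/
lemma exists_concat {Ω : Type*} {m : MeasurableSpace Ω} {β : Type*} [MeasurableSpace β] {A : ℕ → Set Ω}
    (hA : ∀ k, MeasurableSet[m] (A k)) (hd : Pairwise fun i j => Disjoint (A i) (A j))
    (hu : ⋃ k, A k = univ) (f : ℕ → Ω → β) (hf : ∀ k, Measurable[m] (f k)) :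
    ∃ g : Ω → β, Measurable[m] g ∧ ∀ k, ∀ ω ∈ A k, g ω = f k ω := by
  have hex : ∀ ω, ∃ k, ω ∈ A k := fun ω => mem_iUnion.1 (hu ▸ mem_univ ω)
  choose K hK using hex
  have hKu : ∀ k ω, ω ∈ A k → K ω = k := fun k ω h => by
    by_contra hne
    exact disjoint_left.1 (hd hne) (hK ω) h
  refine ⟨fun ω => f (K ω) ω, ?_, fun k ω h => by simp only [hKu k ω h]⟩
  intro s hs
  have : (fun ω => f (K ω) ω) ⁻¹' s = ⋃ k, A k ∩ f k ⁻¹' s := by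
    ext ω
    simp only [mem_preimage, mem_iUnion, mem_inter_iff]
    exact ⟨fun h => ⟨K ω, hK ω, h⟩, fun ⟨k, h1, h2⟩ => by rwa [hKu k ω h1]⟩
  rw [this]
  exact MeasurableSet.iUnion fun k => (hA k).inter (hf k hs)

variable {Ω : Type*} {F : MeasurableSpace Ω} [mΩ : MeasurableSpace Ω] {P : Measure Ω}
  {φ : ℝ≥0 → ℝ≥0∞}

/-! ### The functionals `μ_y` are conditionally order continuous -/

lemma isStable_of_isLinearMap (hF : F ≤ mΩ) {V W : Type*} [AddCommGroup V] [Module (L0F F P) V]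
    [AddCommGroup W] [Module (L0F F P) W] {f : V → W} (hf : IsLinearMap (L0F F P) f) :
    IsStable P hF f := fun A _ xs x h k => by
  rw [← hf.map_smul, h k, hf.map_smul]

lemma lintegral_enorm_weight_mul_condE_le [IsFiniteMeasure P] (hF : F ≤ mΩ) {x : Ω →ₘ[P] ℝ}
    {w : Ω → ℝ≥0} (hw : IsWeight F w) (hx : Integrable (fun ω => (w ω : ℝ) * x ω) P) :
    ∫⁻ ω, ‖(w ω : ℝ) * (condE F P x : Ω →ₘ[P] ℝ) ω‖ₑ ∂P ≤ ∫⁻ ω, ‖(w ω : ℝ) * x ω‖ₑ ∂P := by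
  have h := eLpNorm_condExp_le_eLpNorm (m := F) (μ := P) (fun ω => (w ω : ℝ) * x ω)
    (le_refl (1 : ℝ≥0∞))
  rw [← eLpNorm_congr_ae (weight_mul_condE hF hw hx)] at h
  simpa only [eLpNorm_one_eq_lintegral_enorm] using h

/-- A form of conditional dominated convergence. -/
lemma nonpos_of_le_abs_condE [IsFiniteMeasure P] (hF : F ≤ mΩ) {x : ℕ → Ω →ₘ[P] ℝ}
    {z v : Ω →ₘ[P] ℝ} (hz : z ∈ L1F F P) (hxz : ∀ n, ∀ᵐ ω ∂P, |x n ω| ≤ |z ω|)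
    (hx : ∀ᵐ ω ∂P, Tendsto (fun n => x n ω) atTop (𝓝 0))
    (hv : ∀ n, ∀ᵐ ω ∂P, v ω ≤ |(condE F P (x n) : Ω →ₘ[P] ℝ) ω|) : ∀ᵐ ω ∂P, v ω ≤ 0 := by
  obtain ⟨w, hw, hi⟩ := (mem_L1F_iff hF).1 hz
  have hwm : Measurable fun ω => (w ω : ℝ) := (hw.measurable hF).coe_nnreal_real
  have hlim : Tendsto (fun n => ∫⁻ ω, ‖(w ω : ℝ) * x n ω‖ₑ ∂P) atTop (𝓝 (∫⁻ _, 0 ∂P)) := by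
    refine tendsto_lintegral_of_dominated_convergence (fun ω => ‖(w ω : ℝ) * z ω‖ₑ)
      (fun n => (hwm.mul (x n).measurable).enorm) (fun n => ?_) hi.2.ne ?_
    · filter_upwards [hxz n] with ω h
      rw [enorm_mul, enorm_mul]
      exact mul_le_mul_right (enorm_le_iff_norm_le.2 h) _
    · filter_upwards [hx] with ω h
      simpa using (h.const_mul (w ω : ℝ)).enorm
  -- `L¹`-contractivity bounds the integral of the positive part of `w v` by that of `|w x n|`;
  -- almost sure convergence of the conditional expectations is not needed.
  have hle : ∀ n, ∫⁻ ω, ENNReal.ofReal (w ω * v ω) ∂P ≤ ∫⁻ ω, ‖(w ω : ℝ) * x n ω‖ₑ ∂P := by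
    intro n
    refine le_trans (lintegral_mono_ae ?_) (lintegral_enorm_weight_mul_condE_le hF hw
      (hw.integrable_of_le hF hi (fun _ => le_rfl) (hxz n)))
    filter_upwards [hv n] with ω h
    rw [← ofReal_norm, norm_mul, NNReal.norm_eq]
    exact ENNReal.ofReal_le_ofReal (by gcongr; exact h)
  have h0 := ge_of_tendsto' hlim hle
  have hm : Measurable fun ω => ENNReal.ofReal (w ω * v ω) :=
    (hwm.mul v.measurable).ennreal_ofReal
  rw [lintegral_zero, nonpos_iff_eq_zero, lintegral_eq_zero_iff hm] at h0
  filter_upwards [h0] with ω h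
  have h1 := ENNReal.ofReal_eq_zero.1 h
  by_contra hcon
  exact absurd h1 (not_le.2 (mul_pos (NNReal.coe_pos.2 (hw.pos ω)) (not_le.1 hcon)))

lemma isLinearMap_muFun [IsFiniteMeasure P] (hF : F ≤ mΩ) (hφ : IsYoung φ) {y : Ω →ₘ[P] ℝ}
    (hy : ∀ x ∈ orlicz F P hφ, x * y ∈ L1F F P) : IsLinearMap (L0F F P) (muFun F P hφ y) where
  map_add x x' := by
    simp only [muFun, Submodule.coe_add, add_mul]
    exact condE_add hF (hy _ x.2) (hy _ x'.2)
  map_smul a x := by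
    simp only [muFun, Submodule.coe_smul, Subring.smul_def, smul_eq_mul, mul_assoc]
    exact condE_mul hF (hy _ x.2) a

lemma mem_L1F_abs {x : Ω →ₘ[P] ℝ} [IsFiniteMeasure P] (hF : F ≤ mΩ) (hx : x ∈ L1F F P) :
    |x| ∈ L1F F P := by
  refine L1F_of_abs_le hF hx ?_
  filter_upwards [AEEqFun.coeFn_abs x] with ω h
  rw [h, abs_abs]

lemma ae_abs_le_of_mem_Icc {x z : Ω →ₘ[P] ℝ} (h : z ∈ Icc (-|x|) |x|) :
    ∀ᵐ ω ∂P, |z ω| ≤ |x ω| := by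
  filter_upwards [AEEqFun.coeFn_le.2 h.1, AEEqFun.coeFn_le.2 h.2, AEEqFun.coeFn_abs x,
    AEEqFun.coeFn_neg |x|] with ω h1 h2 h3 h4
  rw [h4, Pi.neg_apply, h3] at h1
  rw [h3] at h2
  exact abs_le.2 ⟨h1, h2⟩

lemma mem_Icc_of_ae_abs_le {x z : Ω →ₘ[P] ℝ} (h : ∀ᵐ ω ∂P, |z ω| ≤ x ω) : z ∈ Icc (-x) x := by
  constructor <;> rw [← AEEqFun.coeFn_le]
  · filter_upwards [h, AEEqFun.coeFn_neg x] with ω h1 h2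
    rw [h2]
    exact (abs_le.1 h1).1
  · filter_upwards [h] with ω h1 using (abs_le.1 h1).2

lemma zero_le_abs (x : Ω →ₘ[P] ℝ) : 0 ≤ |x| := by
  rw [← AEEqFun.coeFn_le]
  filter_upwards [AEEqFun.coeFn_abs x, AEEqFun.coeFn_zero (μ := P) (α := Ω) (β := ℝ)] with ω h h'
  rw [h, h']
  exact abs_nonneg _

/-- On the order interval of `x` the bound is `E[|x y| | F]`. For order continuity, a sequence in
`D` decreasing to `0` is dominated by its first term, and conditional dominated convergence applies.
-/
lemma muFun_mem_orderDual [IsFiniteMeasure P] (hF : F ≤ mΩ) (hφ : IsYoung φ) {y : Ω →ₘ[P] ℝ}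
    (hy : ∀ x ∈ orlicz F P hφ, x * y ∈ L1F F P) : muFun F P hφ y ∈ orderDual hF hφ := by
  have hlin := isLinearMap_muFun hF hφ hy
  refine ⟨⟨isStable_of_isLinearMap hF hlin, hlin⟩, fun x => ?_, fun D hne _ hdir hglb => ?_⟩
  · have hL := mem_L1F_abs hF (hy x x.2)
    refine ⟨condE F P |(x : Ω →ₘ[P] ℝ) * y|, ?_, fun z hz => mem_Icc_of_ae_abs_le ?_⟩
    · rw [← AEEqFun.coeFn_le]
      filter_upwards [abs_condE_le hF (x := 0) hL (by
        filter_upwards [AEEqFun.coeFn_abs ((x : Ω →ₘ[P] ℝ) * y),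
          AEEqFun.coeFn_zero (μ := P) (α := Ω) (β := ℝ)] with ω h h'
        rw [h, h']; simp), AEEqFun.coeFn_zero (μ := P) (α := Ω) (β := ℝ)] with ω h h'
      rw [h']
      exact (abs_nonneg _).trans h
    · refine abs_condE_le hF hL ?_
      filter_upwards [ae_abs_le_of_mem_Icc hz, AEEqFun.coeFn_abs ((x : Ω →ₘ[P] ℝ) * y),
        AEEqFun.coeFn_mul (x : Ω →ₘ[P] ℝ) y, AEEqFun.coeFn_mul (z : Ω →ₘ[P] ℝ) y] with ω h1 h2 h3 h4
      rw [h2, h3, h4, Pi.mul_apply, Pi.mul_apply, abs_mul, abs_mul]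
      gcongr
  · obtain ⟨s, hs, hanti, hlim⟩ := exists_antitone_tendsto_zero (hne.image _) (by
      rintro _ ⟨a, ha, rfl⟩ _ ⟨b, hb, rfl⟩
      obtain ⟨c, hc, h1, h2⟩ := hdir a ha b hb
      exact ⟨_, ⟨c, hc, rfl⟩, h1, h2⟩) hglb
    choose d hd hds using hs
    refine ⟨?_, fun v hv => ?_⟩
    · rintro _ ⟨x, _, rfl⟩
      exact zero_le_abs _
    rw [← AEEqFun.coeFn_le]
    have h0 : ∀ n, ∀ᵐ ω ∂P, 0 ≤ s n ω := fun n => coeFn_nonneg (hglb.1 ⟨d n, hd n, hds n⟩)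
    have key := nonpos_of_le_abs_condE hF (x := fun n => (s n) * y) (z := s 0 * y) (v := v)
      (hds 0 ▸ hy _ (d 0).2) (fun n => ?_) ?_ fun n => ?_
    · filter_upwards [key, AEEqFun.coeFn_zero (μ := P) (α := Ω) (β := ℝ)] with ω h h'
      rwa [h']
    · filter_upwards [AEEqFun.coeFn_mul (s n) y, AEEqFun.coeFn_mul (s 0) y, h0 n,
        AEEqFun.coeFn_le.2 (hanti n.zero_le)] with ω h1 h2 h3 h4
      rw [h1, h2, Pi.mul_apply, Pi.mul_apply, abs_mul, abs_mul, abs_of_nonneg h3,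
        abs_of_nonneg (h3.trans h4)]
      gcongr
    · filter_upwards [hlim, ae_all_iff.2 fun n => AEEqFun.coeFn_mul (s n) y] with ω h1 h2
      simp only [h2, Pi.mul_apply]
      simpa using h1.mul_const (y ω)
    · filter_upwards [AEEqFun.coeFn_le.2 (hv ⟨d n, hd n, rfl⟩),
        AEEqFun.coeFn_abs (muFun F P hφ y (d n) : Ω →ₘ[P] ℝ)] with ω h1 h2
      rw [h2] at h1
      simpa only [muFun, hds n] using h1

/-! ### Indicators and injectivity -/

/-- A bounded measurable function as an element of the Orlicz-type module. -/
def bddElem [IsFiniteMeasure P] (hF : F ≤ mΩ) (hφ : IsYoung φ) (g : Ω → ℝ) (hg : Measurable g)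
    (C : ℝ≥0) (hC : ∀ ω, |g ω| ≤ C) : orlicz F P hφ :=
  ⟨AEEqFun.mk g hg.aestronglyMeasurable, mem_orlicz_of_bounded hF hφ C (by
    filter_upwards [AEEqFun.coeFn_mk g (hg.aestronglyMeasurable (μ := P))] with ω h
    rw [h]; exact hC ω)⟩

lemma coeFn_bddElem [IsFiniteMeasure P] (hF : F ≤ mΩ) (hφ : IsYoung φ) {g : Ω → ℝ}
    (hg : Measurable g) {C : ℝ≥0} (hC : ∀ ω, |g ω| ≤ C) :
    ((bddElem hF hφ g hg C hC : orlicz F P hφ) : Ω →ₘ[P] ℝ) =ᵐ[P] g := AEEqFun.coeFn_mk _ _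

/-- The indicator function of a measurable set, as an element of the Orlicz-type module. -/
def indElem [IsFiniteMeasure P] (hF : F ≤ mΩ) (hφ : IsYoung φ) (A : Set Ω) (hA : MeasurableSet A) :
    orlicz F P hφ :=
  bddElem hF hφ _ (measurable_const.indicator hA) 1 (abs_indicator_one_le A)

lemma coeFn_indElem [IsFiniteMeasure P] (hF : F ≤ mΩ) (hφ : IsYoung φ) {A : Set Ω}
    (hA : MeasurableSet A) : ((indElem hF hφ A hA : orlicz F P hφ) : Ω →ₘ[P] ℝ) =ᵐ[P]
      A.indicator fun _ => (1 : ℝ) := coeFn_bddElem hF hφ _ _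

lemma coeFn_ind (hF : F ≤ mΩ) (A : FSet F) : ((ind P hF A : L0F F P) : Ω →ₘ[P] ℝ) =ᵐ[P]
    A.1.indicator fun _ => (1 : ℝ) := AEEqFun.coeFn_mk _ _

/-- The test element is the indicator of `{y' < y}`. The two weighted integrands are ordered and
have equal integrals, so they coincide almost surely, which makes that set null. -/
lemma ae_le_of_muFun_eq [IsFiniteMeasure P] (hF : F ≤ mΩ) (hφ : IsYoung φ) {y y' : Ω →ₘ[P] ℝ}
    (hy : ∀ x ∈ orlicz F P hφ, x * y ∈ L1F F P) (hy' : ∀ x ∈ orlicz F P hφ, x * y' ∈ L1F F P)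
    (h : muFun F P hφ y = muFun F P hφ y') : ∀ᵐ ω ∂P, y ω ≤ y' ω := by
  have hA : MeasurableSet {ω | y' ω < y ω} := measurableSet_lt y'.measurable y.measurable
  let x := indElem (P := P) hF hφ _ hA
  have hx : condE F P ((x : Ω →ₘ[P] ℝ) * y) = condE F P ((x : Ω →ₘ[P] ℝ) * y') := congrFun h x
  obtain ⟨w, hw, i, i'⟩ := exists_common_weight hF (hy x x.2) (hy' x x.2)
  have e := integral_weight_mul_condE hF hw i
  rw [hx, integral_weight_mul_condE hF hw i'] at e
  have hle : (fun ω => (w ω : ℝ) * ((x : Ω →ₘ[P] ℝ) * y') ω) ≤ᵐ[P]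
      fun ω => (w ω : ℝ) * ((x : Ω →ₘ[P] ℝ) * y) ω := by
    filter_upwards [AEEqFun.coeFn_mul (x : Ω →ₘ[P] ℝ) y, AEEqFun.coeFn_mul (x : Ω →ₘ[P] ℝ) y',
      coeFn_indElem hF hφ hA] with ω h1 h2 h3
    rw [h1, h2, Pi.mul_apply, Pi.mul_apply, h3]
    by_cases hω : y' ω < y ω
    · simp only [indicator_of_mem (show ω ∈ {ω | y' ω < y ω} from hω), one_mul]
      gcongr
    · simp [indicator_of_notMem (show ω ∉ {ω | y' ω < y ω} from hω)]
  filter_upwards [(integral_eq_iff_of_ae_le i' i hle).1 e, AEEqFun.coeFn_mul (x : Ω →ₘ[P] ℝ) y,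
    AEEqFun.coeFn_mul (x : Ω →ₘ[P] ℝ) y', coeFn_indElem hF hφ hA] with ω h0 h1 h2 h3
  by_contra hω
  rw [not_le] at hω
  rw [h1, h2, Pi.mul_apply, Pi.mul_apply, h3,
    indicator_of_mem (show ω ∈ {ω | y' ω < y ω} from hω), one_mul, one_mul] at h0
  exact hω.ne (mul_left_cancel₀ (NNReal.coe_ne_zero.2 (hw.pos ω).ne') h0)

lemma injOn_muFun [IsFiniteMeasure P] (hF : F ≤ mΩ) (hφ : IsYoung φ) :
    InjOn (muFun F P hφ) (orliczSet F P (conj φ)) := by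
  intro y hy y' hy' h
  have h1 := fun x hx => mul_mem_L1F hF hφ (x := x) hx hy
  have h2 := fun x hx => mul_mem_L1F hF hφ (x := x) hx hy'
  refine AEEqFun.ext ?_
  filter_upwards [ae_le_of_muFun_eq hF hφ h1 h2 h, ae_le_of_muFun_eq hF hφ h2 h1 h.symm]
    with ω a b using le_antisymm a b

/-! ### Concatenations -/

lemma subset_ccHull (hF : F ≤ mΩ) {V : Type*} [AddCommGroup V] [Module (L0F F P) V] (S : Set V) :
    S ⊆ ccHull P hF S := by
  intro x hx
  refine ⟨fun k => if k = 0 then ⟨univ, @MeasurableSet.univ _ F⟩ else ⟨∅, @MeasurableSet.empty _ F⟩,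
    ⟨fun i j hij => ?_, eq_univ_of_forall fun ω => mem_iUnion.2 ⟨0, by simp⟩⟩,
    fun _ => x, fun _ => hx, fun _ => rfl⟩
  by_cases hi : i = 0
  · have hj : j ≠ 0 := fun h => hij (hi.trans h.symm)
    simp [hj]
  · simp [hi]

/-- The scales of the pieces are pasted into one scale; conditional expectations are local on sets
of `F`, so finiteness passes over piece by piece. -/
lemma concat_mem_orliczSet [IsFiniteMeasure P] (hF : F ≤ mΩ) {ψ : ℝ≥0 → ℝ≥0∞} (hψ : Monotone ψ)
    {A : ℕ → FSet F} (hA : IsPartition F A) {ys : ℕ → Ω →ₘ[P] ℝ}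
    (hys : ∀ k, ys k ∈ orliczSet F P ψ) {y : Ω →ₘ[P] ℝ}
    (hy : ∀ k, ∀ᵐ ω ∂P, ω ∈ (A k).1 → y ω = ys k ω) : y ∈ orliczSet F P ψ := by
  choose l hl h using hys
  choose b hb hlb using fun k => exists_measurable_rep (l k)
  obtain ⟨c, hc, hcb⟩ := exists_concat (fun k => (A k).2) hA.1 hA.2 b hb
  have hcl := coeFn_toL0F (P := P) hF c hc
  have hall : ∀ p : Ω → Prop, (∀ k, ∀ᵐ ω ∂P, ω ∈ (A k).1 → p ω) → ∀ᵐ ω ∂P, p ω := by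
    intro p hp
    filter_upwards [ae_all_iff.2 hp] with ω hω
    obtain ⟨k, hk⟩ := mem_iUnion.1 (hA.2 ▸ mem_univ ω : ω ∈ ⋃ k, (A k).1)
    exact hω k hk
  refine ⟨toL0F hF c hc, hall _ fun k => ?_, hall _ fun k => ?_⟩
  · filter_upwards [hcl, hl k, hlb k] with ω h1 h2 h3 hω
    rwa [h1, hcb k ω hω, ← h3]
  · have e := condLExp_eqOn hF
      (measurable_comp_div hψ y (toL0F hF c hc : L0F F P)).aemeasurable
      (measurable_comp_div hψ (ys k) (l k)).aemeasurable (A k).2 (by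
        filter_upwards [hcl, hlb k, hy k] with ω h1 h2 h3 hω
        rw [h1, hcb k ω hω, ← h2, h3 hω])
    filter_upwards [e, h k] with ω h1 h2 hω
    rw [h1 hω]
    exact h2

/-- If `f` is a concatenation of `μ_{y_k}`, then pasting the `y_k` along the same partition gives
`y` with `f = μ_y`, because indicators of sets of `F` can be pulled out of `condE`. -/
lemma ccHull_image_muFun [IsFiniteMeasure P] (hF : F ≤ mΩ) (hφ : IsYoung φ) :
    ccHull P hF (muFun F P hφ '' orliczSet F P (conj φ)) =
      muFun F P hφ '' orliczSet F P (conj φ) := by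
  refine Subset.antisymm ?_ (subset_ccHull hF _)
  rintro f ⟨A, hA, fs, hfs, hf⟩
  choose ys hys hyf using hfs
  obtain ⟨g, hg, hgy⟩ := exists_concat (fun k => hF _ (A k).2) hA.1 hA.2 (fun k => ⇑(ys k))
    (fun k => (ys k).measurable)
  have hy : ∀ k, ∀ᵐ ω ∂P, ω ∈ (A k).1 →
      (AEEqFun.mk g hg.aestronglyMeasurable : Ω →ₘ[P] ℝ) ω = ys k ω := fun k => by
    filter_upwards [AEEqFun.coeFn_mk g (hg.aestronglyMeasurable (μ := P))] with ω h1 hω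
    rw [h1, hgy k ω hω]
  set y : Ω →ₘ[P] ℝ := AEEqFun.mk g hg.aestronglyMeasurable
  have hym := concat_mem_orliczSet hF (conj_mono φ) hA hys hy
  refine ⟨y, hym, funext fun x => L0F_ext ?_⟩
  have hk : ∀ k, ∀ᵐ ω ∂P, ω ∈ (A k).1 →
      (muFun F P hφ y x : Ω →ₘ[P] ℝ) ω = (f x : Ω →ₘ[P] ℝ) ω := fun k => by
    have e1 : ind P hF (A k) * muFun F P hφ y x = ind P hF (A k) * muFun F P hφ (ys k) x := by
      simp only [muFun]
      rw [← condE_mul hF (mul_mem_L1F hF hφ x.2 hym), ← condE_mul hF (mul_mem_L1F hF hφ x.2 (hys k))]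
      congr 1
      refine AEEqFun.ext ?_
      filter_upwards [AEEqFun.coeFn_mul (ind P hF (A k) : Ω →ₘ[P] ℝ) ((x : Ω →ₘ[P] ℝ) * y),
        AEEqFun.coeFn_mul (ind P hF (A k) : Ω →ₘ[P] ℝ) ((x : Ω →ₘ[P] ℝ) * ys k),
        AEEqFun.coeFn_mul (x : Ω →ₘ[P] ℝ) y, AEEqFun.coeFn_mul (x : Ω →ₘ[P] ℝ) (ys k),
        coeFn_ind hF (A k), hy k] with ω h1 h2 h3 h4 h5 h6
      rw [h1, h2, Pi.mul_apply, Pi.mul_apply, h3, h4, h5, Pi.mul_apply, Pi.mul_apply]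
      by_cases hω : ω ∈ (A k).1
      · rw [h6 hω]
      · simp [hω]
    have e2 : ind P hF (A k) * f x = ind P hF (A k) * muFun F P hφ (ys k) x := by
      rw [hyf k]; exact congrFun (hf k) x
    have e3 := congrArg (fun a : L0F F P => (a : Ω →ₘ[P] ℝ)) (e1.trans e2.symm)
    simp only [Subring.coe_mul] at e3
    filter_upwards [AEEqFun.coeFn_mul (ind P hF (A k) : Ω →ₘ[P] ℝ) (muFun F P hφ y x),
      AEEqFun.coeFn_mul (ind P hF (A k) : Ω →ₘ[P] ℝ) (f x), coeFn_ind hF (A k)] with ω h1 h2 h3 hω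
    rw [e3, h2, Pi.mul_apply, Pi.mul_apply, h3, indicator_of_mem hω, one_mul, one_mul] at h1
    exact h1.symm
  filter_upwards [ae_all_iff.2 hk] with ω hω
  obtain ⟨k, hk⟩ := mem_iUnion.1 (hA.2 ▸ mem_univ ω : ω ∈ ⋃ k, (A k).1)
  exact hω k hk

end CondOrlicz

end

noncomputable section

namespace CondOrlicz

/-! ### Young functions and their conjugates -/

lemma IsYoung.map_mul_le {φ : ℝ≥0 → ℝ≥0∞} (hφ : IsYoung φ) {c : ℝ≥0} (hc : c ≤ 1) (t : ℝ≥0) :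
    φ (c * t) ≤ c * φ t := by
  have h := hφ.convex.2 (mem_univ t) (mem_univ 0) (zero_le (a := c)) (zero_le (a := 1 - c))
    (add_tsub_cancel_of_le hc)
  simpa [hφ.map_zero, ENNReal.smul_def] using h

lemma IsYoung.bddAbove_range {φ : ℝ≥0 → ℝ≥0∞} (hφ : IsYoung φ) {q : ℕ → ℝ≥0}
    (hq : ∑' k, φ (q k) < ∞) : BddAbove (range q) := by
  obtain ⟨T, hT⟩ := (hφ.tendsto_top.eventually (lt_mem_nhds hq)).exists
  refine ⟨T, ?_⟩
  rintro _ ⟨k, rfl⟩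
  by_contra h
  exact absurd ((hT.trans_le (hφ.mono (not_le.1 h).le)).trans_le (ENNReal.le_tsum k)) (lt_irrefl _)

/-- By left continuity `φ` commutes with the supremum, and a supremum is at most the sum. Finiteness
of the sum also bounds `q`, so that `⨆ k, q k` is a true supremum in `ℝ≥0`. -/
lemma IsYoung.map_iSup_le {φ : ℝ≥0 → ℝ≥0∞} (hφ : IsYoung φ) {q : ℕ → ℝ≥0}
    (hq : ∑' k, φ (q k) < ∞) : φ (⨆ k, q k) ≤ ∑' k, φ (q k) := by
  have hb := hφ.bddAbove_range hq
  rw [iSup, MonotoneOn.map_csSup_of_continuousWithinAt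
    ((hφ.leftContinuous _).mono fun a ha => le_csSup hb ha) (hφ.mono.monotoneOn _)
    (range_nonempty q) hb]
  refine sSup_le ?_
  rintro _ ⟨_, ⟨k, rfl⟩, rfl⟩
  exact ENNReal.le_tsum k

lemma conj_zero (φ : ℝ≥0 → ℝ≥0∞) : conj φ 0 = 0 := by simp [conj]

/-- Replacing `r` by a slightly smaller member of the dense sequence costs little in the linear term
and does not increase `φ`, so monotonicity alone suffices. -/
lemma conj_eq_iSup_of_denseRange {φ : ℝ≥0 → ℝ≥0∞} (hφ : Monotone φ) {t : ℕ → ℝ≥0}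
    (ht : DenseRange t) (s : ℝ≥0) : conj φ s = ⨆ j, ((t j * s : ℝ≥0) : ℝ≥0∞) - φ (t j) := by
  refine le_antisymm (iSup_le fun r => le_of_forall_lt fun c hc => ?_)
    (iSup_le fun j => le_iSup (fun t : ℝ≥0 => ((t * s : ℝ≥0) : ℝ≥0∞) - φ t) (t j))
  have h1 : c + φ r < ((r * s : ℝ≥0) : ℝ≥0∞) := lt_tsub_iff_right.1 hc
  obtain ⟨d, hd⟩ : ∃ d : ℝ≥0, (d : ℝ≥0∞) = c + φ r := ⟨_, ENNReal.coe_toNNReal h1.ne_top⟩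
  rw [← hd, ENNReal.coe_lt_coe] at h1
  have hs : 0 < s := pos_iff_ne_zero.2 fun h => by simp [h] at h1
  obtain ⟨j, hj⟩ := ht.exists_mem_open isOpen_Ioo (nonempty_Ioo.2 ((div_lt_iff₀ hs).2 h1))
  refine lt_of_lt_of_le ?_ (le_iSup _ j)
  refine lt_tsub_iff_right.2 (lt_of_le_of_lt (add_le_add_right (hφ hj.2.le) c) ?_)
  rw [← hd, ENNReal.coe_lt_coe]
  exact (div_lt_iff₀ hs).1 hj.1

/-- Measurable approximate maximisers in the definition of the conjugate function. -/
lemma exists_approx_conj {φ : ℝ≥0 → ℝ≥0∞} (hφ : IsYoung φ) :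
    ∃ (h : ℕ → ℝ≥0 → ℝ≥0∞) (ξ : ℕ → ℝ≥0 → ℝ≥0), (∀ m, Measurable (h m)) ∧
      (∀ m, Measurable (ξ m)) ∧ Monotone h ∧ (∀ s, ⨆ m, h m s = conj φ s) ∧
      (∀ m s, φ (ξ m s) + h m s ≤ ((ξ m s * s : ℝ≥0) : ℝ≥0∞)) ∧
      ∀ m, ∃ M : ℝ≥0, ∀ s, φ (ξ m s) ≤ M := by
  let t := TopologicalSpace.denseSeq ℝ≥0
  let g : ℕ → ℝ≥0 → ℝ≥0∞ := fun j s => ((t j * s : ℝ≥0) : ℝ≥0∞) - φ (t j)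
  have hg : ∀ j, Measurable (g j) := fun j =>
    ((measurable_const.mul measurable_id).coe_nnreal_ennreal).sub measurable_const
  -- Running maximum of `0` and the `g j`, paired with a point that attains it; the start `(0, 0)`
  -- is legitimate since `φ 0 = 0`. Updating only on a strict increase ensures `φ (t m) < ∞` for
  -- every selected point.
  let p : ℕ → ℝ≥0 → ℝ≥0∞ × ℝ≥0 := fun m => Nat.rec (fun _ => (0, 0))
    (fun j q s => if (q s).1 < g j s then (g j s, t j) else q s) m
  have p0 : ∀ s, p 0 s = (0, 0) := fun s => rfl
  have ps : ∀ m s, p (m + 1) s = if (p m s).1 < g m s then (g m s, t m) else p m s :=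
    fun m s => rfl
  have hp : ∀ m, Measurable (p m) := fun m => by
    induction m with
    | zero => exact measurable_const
    | succ m ih =>
      exact Measurable.ite (measurableSet_lt ih.fst (hg m)) ((hg m).prodMk measurable_const) ih
  have hmax : ∀ m s, (p (m + 1) s).1 = max (p m s).1 (g m s) := fun m s => by
    rw [ps]
    split_ifs with h
    · exact (max_eq_right h.le).symm
    · exact (max_eq_left (not_lt.1 h)).symm
  refine ⟨fun m s => (p m s).1, fun m s => (p m s).2, fun m => (hp m).fst, fun m => (hp m).snd,
    monotone_nat_of_le_succ fun m s => (hmax m s).symm ▸ le_max_left _ _, fun s => ?_,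
    fun m s => ?_, fun m => ?_⟩
  · rw [conj_eq_iSup_of_denseRange hφ.mono (TopologicalSpace.denseRange_denseSeq ℝ≥0)]
    refine le_antisymm (iSup_le fun m => ?_) (iSup_le fun j => ?_)
    · induction m with
      | zero => simp [p0]
      | succ m ih =>
        simp only [hmax]
        exact max_le ih (le_iSup (fun j => g j s) m)
    · exact le_trans ((le_max_right _ _).trans (hmax j s).ge) (le_iSup (fun m => (p m s).1) (j + 1))
  · induction m with
    | zero => simp [p0, hφ.map_zero]
    | succ m ih =>
      simp only [ps]
      split_ifs with h
      · have : φ (t m) ≤ ((t m * s : ℝ≥0) : ℝ≥0∞) :=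
          (tsub_pos_iff_lt.1 (bot_le.trans_lt h)).le
        exact (add_tsub_cancel_of_le this).le
      · exact ih
  · induction m with
    | zero => exact ⟨0, fun s => by simp [p0, hφ.map_zero]⟩
    | succ m ih =>
      obtain ⟨M, hM⟩ := ih
      refine ⟨max M (φ (t m)).toNNReal, fun s => ?_⟩
      simp only [ps]
      split_ifs with h
      · have : φ (t m) < ((t m * s : ℝ≥0) : ℝ≥0∞) := tsub_pos_iff_lt.1 (bot_le.trans_lt h)
        refine le_trans ?_ (ENNReal.coe_le_coe.2 (le_max_right _ _))
        rw [ENNReal.coe_toNNReal this.ne_top]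
      · exact (hM s).trans (ENNReal.coe_le_coe.2 (le_max_left _ _))

variable {Ω : Type*} {F : MeasurableSpace Ω} [mΩ : MeasurableSpace Ω] {P : Measure Ω}
  {φ : ℝ≥0 → ℝ≥0∞}

/-! ### Elements integrating the Orlicz-type module lie in the conjugate module -/

lemma exists_measure_le_of_iSup_eq_top [IsFiniteMeasure P] {B : Set Ω} (hB : MeasurableSet B)
    {β : ℕ → Ω → ℝ≥0∞} (hβ : ∀ m, Measurable (β m))
    (hmono : ∀ᵐ ω ∂P, Monotone fun m => β m ω) (htop : ∀ᵐ ω ∂P, ω ∈ B → ⨆ m, β m ω = ∞)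
    {ε : ℝ≥0∞} (hε : 0 < ε) : ∃ m, P (B ∩ {ω | β m ω < 1}) ≤ ε := by
  -- The `β m` increase only almost surely; intersecting over `i ≤ m` makes the sets decrease
  -- everywhere, as continuity from above requires.
  have hlim := tendsto_measure_iInter_atTop (μ := P) (s := fun m => ⋂ i ≤ m, B ∩ {ω | β i ω < 1})
    (fun m => (MeasurableSet.iInter fun i => MeasurableSet.iInter fun _ =>
      hB.inter (measurableSet_lt (hβ i) measurable_const)).nullMeasurableSet)
    (fun m n hmn => biInter_subset_biInter_left fun i hi => le_trans hi hmn)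
    ⟨0, measure_ne_top _ _⟩
  have hz : P (⋂ m, ⋂ i ≤ m, B ∩ {ω | β i ω < 1}) = 0 := by
    refine measure_eq_zero_iff_ae_notMem.2 ?_
    filter_upwards [htop] with ω h hω
    have h1 : ∀ i, ω ∈ B ∩ {ω | β i ω < 1} := fun i =>
      mem_iInter₂.1 (mem_iInter.1 hω i) i le_rfl
    have h2 : ⨆ m, β m ω ≤ 1 := iSup_le fun m => (h1 m).2.le
    rw [h (h1 0).1] at h2
    exact absurd h2 (by simp)
  rw [hz] at hlim
  obtain ⟨m, hm⟩ := (hlim.eventually (gt_mem_nhds hε)).exists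
  refine ⟨m, le_trans (measure_mono_ae ?_) hm.le⟩
  filter_upwards [hmono] with ω h hω
  exact mem_iInter₂.2 fun i hi => ⟨hω.1, lt_of_le_of_lt (h hi) hω.2⟩

/-- Gliding hump. Let `B` be the set where all these conditional expectations are infinite. For each
`k` a measurable near-maximiser `X k` for `φ*(|y| / 4^k)` is normalised and scaled by `2^{-(k+1)}`.
The supremum `x` of these humps stays in `L^φ`, while almost surely on `B` eventually `E[|x y| | F]
≥ 2^k / 2`. As `x y ∈ L¹_F`, the set `B` is null. -/
lemma ae_exists_condLExp_conj_lt_top [IsFiniteMeasure P] (hF : F ≤ mΩ) (hφ : IsYoung φ)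
    {y : Ω →ₘ[P] ℝ} (hy : ∀ x ∈ orlicz F P hφ, x * y ∈ L1F F P) :
    ∀ᵐ ω ∂P, ∃ k : ℕ, condLExp F P (fun ω => conj φ (‖y ω‖₊ * (4 ^ k)⁻¹)) ω < ∞ := by
  obtain ⟨h, ξ, hh, hξ, hmono, hsup, hle, hbd⟩ := exists_approx_conj hφ
  let a : ℕ → Ω → ℝ≥0 := fun k ω => ‖y ω‖₊ * (4 ^ k)⁻¹
  have ha : ∀ k, Measurable (a k) := fun k => y.measurable.nnnorm.mul measurable_const
  let B : Set Ω := {ω | ∀ k : ℕ, condLExp F P (fun ω => conj φ (a k ω)) ω = ∞}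
  have hBm : MeasurableSet B := by
    have : B = ⋂ k, (condLExp F P (fun ω => conj φ (a k ω))) ⁻¹' {∞} := by
      ext ω; simp [B]
    rw [this]
    exact MeasurableSet.iInter fun k => measurable_condLExp' F P _ (measurableSet_singleton _)
  have hsel : ∀ k : ℕ, ∃ m, P (B ∩ {ω | condLExp F P (fun ω => h m (a k ω)) ω < 1}) ≤
      2⁻¹ ^ (k + 1) := fun k => by
    refine exists_measure_le_of_iSup_eq_top hBm (fun m => measurable_condLExp' F P _) ?_ ?_
      (ENNReal.pow_pos (by simp) _)
    · have := fun m : ℕ => condLExp_mono (mΩ := F) (P := P)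
        (ae_of_all P fun ω => hmono m.le_succ (a k ω))
      filter_upwards [ae_all_iff.2 this] with ω hω
      exact monotone_nat_of_le_succ hω
    · have := condLExp_iSup (P := P) hF (g := fun m ω => h m (a k ω))
        (fun m => (hh m).comp (ha k)) fun i j hij ω => hmono hij _
      simp only [hsup] at this
      filter_upwards [this] with ω h1 hω
      rw [← h1]
      exact hω k
  choose m hm using hsel
  have hgeom : ∑' k : ℕ, (2⁻¹ : ℝ≥0∞) ^ (k + 1) = 1 := by
    rw [ENNReal.tsum_geometric_add_one, ENNReal.one_sub_inv_two, inv_inv]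
    exact ENNReal.inv_mul_cancel (by simp) (by simp)
  -- Borel–Cantelli: almost surely on `B`, the conditional expectation of `h (m k) (a k)` is at
  -- least `1` for all large `k`.
  have hev := ae_eventually_notMem (μ := P) (ne_top_of_le_ne_top (b := 1) (by simp)
    ((ENNReal.tsum_le_tsum hm).trans hgeom.le))
  let X : ℕ → Ω → ℝ≥0 := fun k ω => ξ (m k) (a k ω)
  have hX : ∀ k, Measurable (X k) := fun k => (hξ _).comp (ha k)
  have hφX : ∀ k, Measurable fun ω => φ (X k ω) := fun k => hφ.mono.measurable.comp (hX k)
  let α : ℕ → Ω → ℝ≥0∞ := fun k => condLExp F P fun ω => φ (X k ω)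
  -- The factor `r k` brings `E[φ(X k) | F]` below `1`; being `F`-measurable, it can be pulled out.
  let r : ℕ → Ω → ℝ≥0 := fun k ω => (max (α k ω).toNNReal 1)⁻¹
  have hr : ∀ k, Measurable[F] (r k) := fun k =>
    ((measurable_condLExp F P _).ennreal_toNNReal.max measurable_const).inv
  have hr' : ∀ k, Measurable (r k) := fun k => (hr k).mono hF le_rfl
  have hr1 : ∀ k ω, r k ω ≤ 1 := fun k ω => inv_le_one_of_one_le₀ (le_max_right _ _)
  have hαfin : ∀ k, ∀ᵐ ω ∂P, α k ω < ∞ := fun k => by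
    obtain ⟨M, hM⟩ := hbd (m k)
    refine condLExp_lt_top (ne_top_of_le_ne_top (b := ∫⁻ _, (M : ℝ≥0∞) ∂P) ?_
      (lintegral_mono fun ω => hM _))
    rw [lintegral_const]
    exact ENNReal.mul_ne_top (by simp) (measure_ne_top _ _)
  -- These factors are summable, yet `4^k * c k = 2^k / 2` still tends to infinity.
  let c : ℕ → ℝ≥0 := fun k => 2⁻¹ ^ (k + 1)
  let q : ℕ → Ω → ℝ≥0 := fun k ω => c k * (r k ω * X k ω)
  have hq : ∀ k, Measurable (q k) := fun k => measurable_const.mul ((hr' k).mul (hX k))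
  have hc1 : ∀ k, c k ≤ 1 := fun k => pow_le_one₀ (by positivity) (by norm_num)
  have hqint : ∀ k, ∫⁻ ω, φ (q k ω) ∂P ≤ 2⁻¹ ^ (k + 1) * P univ := fun k => by
    have h1 : ∀ ω, φ (q k ω) ≤ (c k : ℝ≥0∞) * (φ (X k ω) * r k ω) := fun ω => by
      refine (hφ.map_mul_le (hc1 k) _).trans (mul_le_mul_right ?_ _)
      rw [mul_comm (φ _)]
      exact hφ.map_mul_le (hr1 k ω) _
    refine (lintegral_mono h1).trans ?_
    have hm1 : Measurable fun ω => φ (X k ω) * r k ω := (hφX k).mul (hr' k).coe_nnreal_ennreal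
    rw [lintegral_const_mul _ hm1, ← lintegral_mul_condLExp hF (hr k).coe_nnreal_ennreal (hφX k).aemeasurable]
    have hcc : (c k : ℝ≥0∞) = 2⁻¹ ^ (k + 1) := by simp [c, ENNReal.inv_pow]
    rw [hcc, ← setLIntegral_univ, ← setLIntegral_one]
    refine mul_le_mul_right (setLIntegral_mono_ae' MeasurableSet.univ ?_) _
    filter_upwards [hαfin k] with ω hω _
    change α k ω * (r k ω : ℝ≥0∞) ≤ 1
    obtain ⟨b, hb⟩ : ∃ b : ℝ≥0, α k ω = b := ⟨_, (ENNReal.coe_toNNReal hω.ne).symm⟩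
    simp only [r, hb, ENNReal.toNNReal_coe]
    norm_cast
    rw [← div_eq_mul_inv]
    exact div_le_one_of_le₀ (le_max_left _ _) (by positivity)
  have hsumint : ∫⁻ ω, ∑' k, φ (q k ω) ∂P ≠ ∞ := by
    have hm1 : ∀ k, Measurable fun ω => φ (q k ω) := fun k => hφ.mono.measurable.comp (hq k)
    rw [lintegral_tsum fun k => (hm1 k).aemeasurable]
    refine ne_top_of_le_ne_top ?_ (ENNReal.tsum_le_tsum hqint)
    rw [ENNReal.tsum_mul_right]
    exact ENNReal.mul_ne_top (by rw [hgeom]; simp) (measure_ne_top _ _)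
  have hsumfin : ∀ᵐ ω ∂P, ∑' k, φ (q k ω) < ∞ :=
    ae_lt_top (Measurable.tsum fun k => hφ.mono.measurable.comp (hq k)) hsumint
  let x₀ : Ω → ℝ := fun ω => ((⨆ k, q k ω : ℝ≥0) : ℝ)
  have hx₀ : Measurable x₀ := (Measurable.iSup hq).coe_nnreal_real
  let x : Ω →ₘ[P] ℝ := AEEqFun.mk x₀ hx₀.aestronglyMeasurable
  have hxx : x =ᵐ[P] x₀ := AEEqFun.coeFn_mk _ _
  have hxmem : x ∈ orlicz F P hφ := by
    refine ⟨1, ?_, condLExp_lt_top (ne_top_of_le_ne_top hsumint (lintegral_mono_ae ?_))⟩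
    · filter_upwards [AEEqFun.coeFn_one (μ := P) (α := Ω) (β := ℝ)] with ω h1
      rw [OneMemClass.coe_one, h1]; simp
    · filter_upwards [AEEqFun.coeFn_one (μ := P) (α := Ω) (β := ℝ), hxx, hsumfin] with ω h1 h2 h3
      rw [OneMemClass.coe_one, h1, h2]
      have e1 : ‖x₀ ω‖₊ = ⨆ k, q k ω := NNReal.nnnorm_eq _
      rw [e1]
      simpa using hφ.map_iSup_le h3
  have hxy := hy x hxmem
  have hlow : ∀ k, ∀ᵐ ω ∂P, 1 ≤ condLExp F P (fun ω => h (m k) (a k ω)) ω →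
      2⁻¹ * 2 ^ k ≤ condLExp F P (fun ω => ‖(x * y) ω‖ₑ) ω := fun k => by
    have h1 : (fun ω => ((φ (X k ω) + h (m k) (a k ω)) * r k ω) * ((2⁻¹ : ℝ≥0) * 2 ^ k : ℝ≥0))
        ≤ᵐ[P] fun ω => ‖(x * y) ω‖ₑ := by
      filter_upwards [hxx, AEEqFun.coeFn_mul x y, hsumfin] with ω h1 h2 h3
      have hqx : q k ω ≤ ⨆ k, q k ω := le_ciSup (hφ.bddAbove_range h3) k
      rw [h2, Pi.mul_apply, h1, enorm_mul]
      have e1 : ‖x₀ ω‖ₑ = ((⨆ k, q k ω : ℝ≥0) : ℝ≥0∞) := by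
        rw [enorm_eq_nnnorm, NNReal.nnnorm_eq]
      rw [e1]
      refine le_trans ?_ (mul_le_mul_left (ENNReal.coe_le_coe.2 hqx) _)
      refine (mul_le_mul_left (mul_le_mul_left (hle (m k) (a k ω)) _) _).trans (le_of_eq ?_)
      rw [enorm_eq_nnnorm]
      rw [← ENNReal.coe_mul, ← ENNReal.coe_mul, ← ENNReal.coe_mul, ENNReal.coe_inj]
      simp only [q, X, a, c]
      have : (2⁻¹ : ℝ≥0) * 2 ^ k = 2⁻¹ ^ (k + 1) * 4 ^ k := by
        rw [show (4 : ℝ≥0) = 2 * 2 by norm_num, mul_pow, pow_succ, inv_pow]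
        field_simp
      rw [this]
      field_simp
    have hm1 : Measurable fun ω => φ (X k ω) + h (m k) (a k ω) :=
      (hφX k).add ((hh _).comp (ha k))
    have hm2 : Measurable fun ω => (φ (X k ω) + h (m k) (a k ω)) * r k ω :=
      hm1.mul (hr' k).coe_nnreal_ennreal
    filter_upwards [condLExp_mono (mΩ := F) h1, hαfin k,
      condLExp_mul_right hF (c := fun _ => (((2⁻¹ : ℝ≥0) * 2 ^ k : ℝ≥0) : ℝ≥0∞)) measurable_const
        hm2.aemeasurable (P := P),
      condLExp_mul_right hF (hr k).coe_nnreal_ennreal hm1.aemeasurable (P := P),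
      condLExp_add_left (mΩ := F) (fun ω => h (m k) (a k ω)) (hφX k).aemeasurable (P := P)]
      with ω g1 g2 g3 g4 g5 g6
    refine le_trans ?_ g1
    have e5 : condLExp F P (fun ω => φ (X k ω) + h (m k) (a k ω)) ω =
      α k ω + condLExp F P (fun ω => h (m k) (a k ω)) ω := g5
    rw [g3, g4, e5]
    -- This is `(α + 1) / max(α, 1) ≥ 1`: the `φ` term compensates the normalisation where `α` is
    -- large, the `h` term where it is small.
    have e : 1 ≤ (α k ω + condLExp F P (fun ω => h (m k) (a k ω)) ω) * (r k ω : ℝ≥0∞) := by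
      refine le_trans ?_ (mul_le_mul_left (add_le_add_right g6 _) _)
      obtain ⟨b, hb⟩ : ∃ b : ℝ≥0, α k ω = b := ⟨_, (ENNReal.coe_toNNReal g2.ne).symm⟩
      simp only [r, hb, ENNReal.toNNReal_coe]
      norm_cast
      rw [← div_eq_mul_inv, one_le_div₀ (by positivity)]
      exact max_le le_self_add le_add_self
    have e' : ((2⁻¹ * 2 ^ k : ℝ≥0) : ℝ≥0∞) = 2⁻¹ * 2 ^ k := by
      rw [ENNReal.coe_mul, ENNReal.coe_inv (by norm_num)]
      simp
    rw [e']
    exact le_mul_of_one_le_left zero_le e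
  filter_upwards [hev, ae_all_iff.2 hlow, hxy] with ω h1 h2 h3
  by_contra hcon
  have hωB : ω ∈ B := fun k => by
    by_contra hne
    exact hcon ⟨k, lt_top_iff_ne_top.2 hne⟩
  have hev2 : ∀ᶠ k in atTop, 2⁻¹ * (2 : ℝ≥0∞) ^ k ≤ condLExp F P (fun ω => ‖(x * y) ω‖ₑ) ω := by
    filter_upwards [h1] with k hk
    refine h2 k ?_
    by_contra hlt
    exact hk ⟨hωB, not_le.1 hlt⟩
  have hlim : Tendsto (fun k : ℕ => 2⁻¹ * (2 : ℝ≥0∞) ^ k) atTop (𝓝 (2⁻¹ * ∞)) :=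
    ENNReal.Tendsto.const_mul (ENNReal.tendsto_pow_atTop_nhds_top_iff.2 (by norm_num)) (by simp)
  have := le_of_tendsto hlim hev2
  rw [ENNReal.mul_top (by simp)] at this
  exact absurd h3 (not_lt.2 this)

/-- The first `k` with finite conditional expectation depends on `ω` in an `F`-measurable way, so
the scales `4^k` can be pasted along its level sets. -/
lemma mem_orliczSet_conj [IsFiniteMeasure P] (hF : F ≤ mΩ) (hφ : IsYoung φ)
    {y : Ω →ₘ[P] ℝ} (hy : ∀ x ∈ orlicz F P hφ, x * y ∈ L1F F P) : y ∈ orliczSet F P (conj φ) := by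
  let Φ : ℕ → Ω → ℝ≥0∞ := fun k => condLExp F P fun ω => conj φ (‖y ω‖₊ * (4 ^ k)⁻¹)
  have hΦ : ∀ k, Measurable[F] (Φ k) := fun k => measurable_condLExp F P _
  -- The second set, where no `k` works, is null; adding it makes the `E k` cover `Ω` everywhere.
  let E : ℕ → Set Ω := fun k => Φ k ⁻¹' (Iio ∞) ∪ ⋂ j, (Φ j ⁻¹' {∞})
  have hE : ∀ k, MeasurableSet[F] (E k) := fun k => (hΦ k measurableSet_Iio).union
    (MeasurableSet.iInter fun j => hΦ j (measurableSet_singleton _))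
  have hEu : ⋃ k, E k = univ := eq_univ_of_forall fun ω => by
    by_cases h : ∃ k, Φ k ω < ∞
    · obtain ⟨k, hk⟩ := h
      exact mem_iUnion.2 ⟨k, Or.inl hk⟩
    · refine mem_iUnion.2 ⟨0, Or.inr (mem_iInter.2 fun j => ?_)⟩
      by_contra hne
      exact h ⟨j, lt_top_iff_ne_top.2 hne⟩
  let A : ℕ → FSet F := fun k => ⟨disjointed E k, MeasurableSet.disjointed hE k⟩
  have hA : IsPartition F A := ⟨fun i j h => disjoint_disjointed E h, by
    rw [← hEu]; exact iUnion_disjointed⟩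
  have hfin : ∀ k, ∀ᵐ ω ∂P, ω ∈ (A k).1 → Φ k ω < ∞ := fun k => by
    filter_upwards [ae_exists_condLExp_conj_lt_top hF hφ hy] with ω h hω
    rcases disjointed_subset E k hω with h1 | h1
    · exact h1
    · obtain ⟨j, hj⟩ := h
      exact absurd (mem_iInter.1 h1 j) hj.ne
  have hyk : ∀ k, (ind P hF (A k) : Ω →ₘ[P] ℝ) * y =ᵐ[P]
      fun ω => (A k).1.indicator (fun _ => (1 : ℝ)) ω * y ω := fun k => by
    filter_upwards [AEEqFun.coeFn_mul (ind P hF (A k) : Ω →ₘ[P] ℝ) y, coeFn_ind hF (A k)]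
      with ω h1 h2
    rw [h1, Pi.mul_apply, h2]
  have hconj : ∀ k : ℕ, Measurable fun ω => conj φ (‖y ω‖₊ * (4 ^ k)⁻¹) := fun k =>
    (conj_mono φ).measurable.comp (y.measurable.nnnorm.mul measurable_const)
  refine concat_mem_orliczSet hF (conj_mono φ) hA (ys := fun k => (ind P hF (A k) : Ω →ₘ[P] ℝ) * y)
    (fun k => ?_) fun k => ?_
  · have hl := coeFn_toL0F (P := P) hF (fun _ => (4 : ℝ) ^ k) measurable_const
    refine ⟨toL0F hF (fun _ => (4 : ℝ) ^ k) measurable_const, ?_, ?_⟩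
    · filter_upwards [hl] with ω h
      rw [h]; positivity
    · have e : (fun ω => conj φ (‖((ind P hF (A k) : Ω →ₘ[P] ℝ) * y) ω‖₊ *
          ‖(toL0F (P := P) hF (fun _ => (4 : ℝ) ^ k) measurable_const : Ω →ₘ[P] ℝ) ω‖₊⁻¹)) =ᵐ[P]
          fun ω => conj φ (‖y ω‖₊ * (4 ^ k)⁻¹) * (A k).1.indicator (fun _ => (1 : ℝ≥0∞)) ω := by
        filter_upwards [hl, hyk k] with ω h1 h2
        rw [h1, h2]
        by_cases hω : ω ∈ (A k).1
        · simp [hω]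
        · simp [hω, conj_zero]
      filter_upwards [condLExp_congr_ae (mΩ := F) e, hfin k, condLExp_mul_right hF
        (measurable_const.indicator (A k).2) (hconj k).aemeasurable
        (c := (A k).1.indicator (fun _ => (1 : ℝ≥0∞))) (P := P)] with ω h1 h2 h3
      rw [h1]
      refine lt_of_eq_of_lt h3 ?_
      by_cases hω : ω ∈ (A k).1
      · simpa [hω] using h2 hω
      · simp [hω]
  · filter_upwards [hyk k] with ω h1 hω
    rw [h1]; simp [hω]

end CondOrlicz

end

noncomputable section

namespace CondOrlicz

lemma measurableSet_abs_le {Ω : Type*} {m : MeasurableSpace Ω} {b b' : Ω → ℝ} (hb : Measurable b)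
    (hb' : Measurable b') : MeasurableSet {ω | |b ω| ≤ |b' ω|} :=
  measurableSet_le (continuous_abs.measurable.comp hb) (continuous_abs.measurable.comp hb')

variable {Ω : Type*} {F : MeasurableSpace Ω} [mΩ : MeasurableSpace Ω] {P : Measure Ω}
  {φ : ℝ≥0 → ℝ≥0∞}

/-! ### Locality of conditionally linear functionals -/

lemma ind_smul_eq_iff (hF : F ≤ mΩ) (hφ : IsYoung φ) {A : FSet F} {x x' : orlicz F P hφ} :
    ind P hF A • x = ind P hF A • x' ↔
      ∀ᵐ ω ∂P, ω ∈ A.1 → (x : Ω →ₘ[P] ℝ) ω = (x' : Ω →ₘ[P] ℝ) ω := by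
  have e1 := AEEqFun.coeFn_mul (ind P hF A : Ω →ₘ[P] ℝ) x
  have e2 := AEEqFun.coeFn_mul (ind P hF A : Ω →ₘ[P] ℝ) x'
  constructor
  · intro h
    have h' : (ind P hF A : Ω →ₘ[P] ℝ) * (x : Ω →ₘ[P] ℝ) =
        (ind P hF A : Ω →ₘ[P] ℝ) * (x' : Ω →ₘ[P] ℝ) := congrArg Subtype.val h
    filter_upwards [e1, e2, coeFn_ind hF A] with ω h1 h2 h3 hω
    rw [h', h2, Pi.mul_apply, Pi.mul_apply, h3, indicator_of_mem hω, one_mul, one_mul] at h1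
    exact h1.symm
  · intro h
    refine Subtype.ext (AEEqFun.ext ?_)
    change ((ind P hF A : Ω →ₘ[P] ℝ) * (x : Ω →ₘ[P] ℝ) : Ω →ₘ[P] ℝ) =ᵐ[P]
      ((ind P hF A : Ω →ₘ[P] ℝ) * (x' : Ω →ₘ[P] ℝ) : Ω →ₘ[P] ℝ)
    filter_upwards [e1, e2, coeFn_ind hF A, h] with ω h1 h2 h3 h4
    rw [h1, h2, Pi.mul_apply, Pi.mul_apply, h3]
    by_cases hω : ω ∈ A.1
    · rw [h4 hω]
    · simp [hω]

/-- Linearity over `L⁰(F)` allows multiplication by the indicator of `A`, so `f` is local on sets of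
`F`. -/
lemma map_eqOn (hF : F ≤ mΩ) {hφ : IsYoung φ} {f : orlicz F P hφ → L0F F P}
    (hf : IsLinearMap (L0F F P) f) {A : Set Ω} (hA : MeasurableSet[F] A) {x x' : orlicz F P hφ}
    (h : ∀ᵐ ω ∂P, ω ∈ A → (x : Ω →ₘ[P] ℝ) ω = (x' : Ω →ₘ[P] ℝ) ω) :
    ∀ᵐ ω ∂P, ω ∈ A → (f x : Ω →ₘ[P] ℝ) ω = (f x' : Ω →ₘ[P] ℝ) ω := by
  have e := congrArg f ((ind_smul_eq_iff hF hφ (A := ⟨A, hA⟩)).2 h)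
  rw [hf.map_smul, hf.map_smul, smul_eq_mul, smul_eq_mul] at e
  have e' := congrArg (fun a : L0F F P => (a : Ω →ₘ[P] ℝ)) e
  simp only [Subring.coe_mul] at e'
  filter_upwards [AEEqFun.coeFn_mul (ind P hF ⟨A, hA⟩ : Ω →ₘ[P] ℝ) (f x),
    AEEqFun.coeFn_mul (ind P hF ⟨A, hA⟩ : Ω →ₘ[P] ℝ) (f x'), coeFn_ind hF ⟨A, hA⟩] with ω h1 h2 h3 hω
  rw [e', h2, Pi.mul_apply, Pi.mul_apply, h3, indicator_of_mem (by exact hω), one_mul,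
    one_mul] at h1
  exact h1.symm

lemma orlicz_ext {hφ : IsYoung φ} {x x' : orlicz F P hφ}
    (h : (x : Ω →ₘ[P] ℝ) =ᵐ[P] (x' : Ω →ₘ[P] ℝ)) : x = x' := Subtype.ext (AEEqFun.ext h)

/-! ### Order continuity along sequences -/

lemma exists_randomIndex (hF : F ≤ mΩ) {hφ : IsYoung φ} (d : ℕ → orlicz F P hφ)
    (h0 : ∀ᵐ ω ∂P, ∀ n, 0 ≤ (d n : Ω →ₘ[P] ℝ) ω)
    (hanti : ∀ᵐ ω ∂P, Antitone fun n => (d n : Ω →ₘ[P] ℝ) ω) {N : Ω → ℕ} (hN : Measurable[F] N) :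
    ∃ x : orlicz F P hφ, ∀ᵐ ω ∂P, (x : Ω →ₘ[P] ℝ) ω = (d (N ω) : Ω →ₘ[P] ℝ) ω := by
  have hm : Measurable fun ω => (d (N ω) : Ω →ₘ[P] ℝ) ω :=
    measurable_from_prod_countable_right (f := fun p : ℕ × Ω => (d p.1 : Ω →ₘ[P] ℝ) p.2)
      (fun n => (d n : Ω →ₘ[P] ℝ).measurable) |>.comp ((hN.mono hF le_rfl).prodMk measurable_id)
  have e := AEEqFun.coeFn_mk _ (hm.aestronglyMeasurable (μ := P))
  refine ⟨⟨AEEqFun.mk _ hm.aestronglyMeasurable, mem_orlicz_of_abs_le hφ (d 0).2 ?_⟩, e⟩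
  filter_upwards [e, h0, hanti] with ω h1 h2 h3
  rw [h1, abs_of_nonneg (h2 _), abs_of_nonneg (h2 _)]
  exact h3 (Nat.zero_le _)

/-- The set of all `d_N` with `N ≥ K` an `F`-measurable index has the concatenation property, is
directed and has infimum `0`, so order continuity applies to it. By locality of `f` the values
`|f(d_N)|` are again downward directed, and a sequence of them tends to `0`. The indices need not
grow; the lower bound `K` keeps control of `d_N` itself. -/
lemma exists_randomIndex_tendsto_zero [IsFiniteMeasure P] (hF : F ≤ mΩ) {hφ : IsYoung φ}
    {f : orlicz F P hφ → L0F F P} (hf : f ∈ orderDual hF hφ) (d : ℕ → orlicz F P hφ)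
    (h0 : ∀ᵐ ω ∂P, ∀ n, 0 ≤ (d n : Ω →ₘ[P] ℝ) ω)
    (hanti : ∀ᵐ ω ∂P, Antitone fun n => (d n : Ω →ₘ[P] ℝ) ω)
    (hlim : ∀ᵐ ω ∂P, Tendsto (fun n => (d n : Ω →ₘ[P] ℝ) ω) atTop (𝓝 0)) (K : ℕ) :
    ∃ (N : ℕ → Ω → ℕ) (D : ℕ → orlicz F P hφ), (∀ j, Measurable[F] (N j)) ∧ (∀ j ω, K ≤ N j ω) ∧
      (∀ j, ∀ᵐ ω ∂P, (D j : Ω →ₘ[P] ℝ) ω = (d (N j ω) : Ω →ₘ[P] ℝ) ω) ∧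
      ∀ᵐ ω ∂P, Tendsto (fun j => (f (D j) : Ω →ₘ[P] ℝ) ω) atTop (𝓝 0) := by
  obtain ⟨⟨-, hlin⟩, -, hcont⟩ := hf
  have hrep := fun (N : Ω → ℕ) (hN : Measurable[F] N) => exists_randomIndex hF d h0 hanti hN
  let S : Set (orlicz F P hφ) := {x | ∃ N : Ω → ℕ, Measurable[F] N ∧ (∀ ω, K ≤ N ω) ∧
    ∀ᵐ ω ∂P, (x : Ω →ₘ[P] ℝ) ω = (d (N ω) : Ω →ₘ[P] ℝ) ω}
  have hne : S.Nonempty := ⟨d K, fun _ => K, measurable_const, fun _ => le_rfl, ae_of_all _ fun _ => rfl⟩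
  have hccp : HasCCP P hF S := by
    refine Subset.antisymm ?_ (subset_ccHull hF S)
    rintro x ⟨A, hA, xs, hxs, hx⟩
    choose N hN hNK hNx using hxs
    obtain ⟨M, hM, hMN⟩ := exists_concat (fun k => (A k).2) hA.1 hA.2 N hN
    have hAu : ∀ ω, ∃ k, ω ∈ (A k).1 := fun ω => mem_iUnion.1 (hA.2 ▸ mem_univ ω)
    refine ⟨M, hM, fun ω => ?_, ?_⟩
    · obtain ⟨k, hk⟩ := hAu ω
      rw [hMN k ω hk]
      exact hNK k ω
    · filter_upwards [ae_all_iff.2 fun k => (ind_smul_eq_iff hF hφ).1 (hx k), ae_all_iff.2 hNx]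
        with ω h1 h2
      obtain ⟨k, hk⟩ := hAu ω
      rw [h1 k hk, h2 k, hMN k ω hk]
  have hdir : DirectedOn (fun x y : orlicz F P hφ => (y : Ω →ₘ[P] ℝ) ≤ x) S := by
    rintro x ⟨N, hN, hNK, hx⟩ x' ⟨N', hN', hNK', hx'⟩
    have hM : Measurable[F] fun ω => max (N ω) (N' ω) := hN.max hN'
    obtain ⟨z, hz⟩ := hrep _ hM
    refine ⟨z, ⟨_, hM, fun ω => (hNK ω).trans (le_max_left _ _), hz⟩, AEEqFun.coeFn_le.1 ?_, AEEqFun.coeFn_le.1 ?_⟩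
    · filter_upwards [hx, hz, hanti] with ω h1 h2 h3
      rw [h1, h2]
      exact h3 (le_max_left _ _)
    · filter_upwards [hx', hz, hanti] with ω h1 h2 h3
      rw [h1, h2]
      exact h3 (le_max_right _ _)
  have hglb : IsGLB ((fun x : orlicz F P hφ => (x : Ω →ₘ[P] ℝ)) '' S) 0 := by
    refine ⟨?_, fun v hv => ?_⟩
    · rintro _ ⟨x, ⟨N, -, -, hx⟩, rfl⟩
      rw [← AEEqFun.coeFn_le]
      filter_upwards [AEEqFun.coeFn_zero (μ := P) (α := Ω) (β := ℝ), hx, h0] with ω h1 h2 h3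
      rw [h1, h2]
      exact h3 _
    · have h1 : ∀ n, ∀ᵐ ω ∂P, v ω ≤ (d (K + n) : Ω →ₘ[P] ℝ) ω := fun n =>
        AEEqFun.coeFn_le.2 (hv ⟨d (K + n), ⟨fun _ => K + n, measurable_const,
          fun _ => Nat.le_add_right _ _, ae_of_all _ fun _ => rfl⟩, rfl⟩)
      rw [← AEEqFun.coeFn_le]
      filter_upwards [AEEqFun.coeFn_zero (μ := P) (α := Ω) (β := ℝ), hlim, ae_all_iff.2 h1]
        with ω h2 h3 h4
      rw [h2]
      exact ge_of_tendsto' (h3.comp (tendsto_add_atTop_nat K)) fun n => by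
        simpa [add_comm] using h4 n
  obtain ⟨s, hs, -, hslim⟩ := exists_antitone_tendsto_zero (hne.image _) (by
    rintro _ ⟨x, ⟨N, hN, hNK, hx⟩, rfl⟩ _ ⟨x', ⟨N', hN', hNK', hx'⟩, rfl⟩
    obtain ⟨b, hb, hfb⟩ := exists_measurable_rep (f x)
    obtain ⟨b', hb', hfb'⟩ := exists_measurable_rep (f x')
    have hA : MeasurableSet[F] {ω | |b ω| ≤ |b' ω|} :=
      measurableSet_abs_le hb hb'
    -- Choosing at each point the index with the smaller value of `|f|` gives, by locality, an
    -- element whose value lies below both.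
    have hM : Measurable[F] fun ω => if ω ∈ {ω | |b ω| ≤ |b' ω|} then N ω else N' ω :=
      Measurable.ite hA hN hN'
    obtain ⟨z, hz⟩ := hrep _ hM
    have e1 := map_eqOn hF hlin hA (x := z) (x' := x) (by
      filter_upwards [hz, hx] with ω h1 h2 hω
      rw [h1, h2, if_pos hω])
    have e2 := map_eqOn hF hlin hA.compl (x := z) (x' := x') (by
      filter_upwards [hz, hx'] with ω h1 h2 hω
      rw [h1, h2, if_neg (show ¬|b ω| ≤ |b' ω| from hω)])
    refine ⟨_, ⟨z, ⟨_, hM, fun ω => ?_, hz⟩, rfl⟩, ?_⟩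
    · split_ifs
      exacts [hNK ω, hNK' ω]
    have key : ∀ᵐ ω ∂P, |(f z : Ω →ₘ[P] ℝ) ω| ≤ |(f x : Ω →ₘ[P] ℝ) ω| ∧
        |(f z : Ω →ₘ[P] ℝ) ω| ≤ |(f x' : Ω →ₘ[P] ℝ) ω| := by
      filter_upwards [hfb, hfb', e1, e2] with ω h1 h2 h3 h4
      by_cases hω : |b ω| ≤ |b' ω|
      · rw [h3 hω, h2, h1]
        exact ⟨le_rfl, hω⟩
      · rw [h4 hω, h2, h1]
        exact ⟨(not_le.1 hω).le, le_rfl⟩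
    constructor <;> rw [← AEEqFun.coeFn_le]
    · filter_upwards [key, AEEqFun.coeFn_abs (f z : Ω →ₘ[P] ℝ),
        AEEqFun.coeFn_abs (f x : Ω →ₘ[P] ℝ)] with ω h1 h2 h3
      rw [h2, h3]
      exact h1.1
    · filter_upwards [key, AEEqFun.coeFn_abs (f z : Ω →ₘ[P] ℝ),
        AEEqFun.coeFn_abs (f x' : Ω →ₘ[P] ℝ)] with ω h1 h2 h3
      rw [h2, h3]
      exact h1.2) (hcont S hne hccp hdir hglb)
  choose D hD hDs using hs
  choose N hN hNK hDN using hD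
  refine ⟨N, D, hN, hNK, hDN, ?_⟩
  filter_upwards [hslim, ae_all_iff.2 fun j => AEEqFun.coeFn_abs (f (D j) : Ω →ₘ[P] ℝ)] with ω h1 h2
  refine (tendsto_zero_iff_abs_tendsto_zero _).2 (h1.congr fun j => ?_)
  rw [← hDs j]
  exact h2 j

/-! ### Densities of set functions that are continuous along random indices -/

/-- The continuity condition for a set function along `F`-measurable random indices. -/
def RandomIndexContinuous {Ω : Type*} (F : MeasurableSpace Ω) [MeasurableSpace Ω] (ν : Set Ω → ℝ) :
    Prop :=
  ∀ (U : Set Ω) (A : ℕ → Set Ω), MeasurableSet U → (∀ n, MeasurableSet (A n)) → Antitone A →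
    ⋂ n, A n = ∅ → ∃ N : ℕ → Ω → ℕ, (∀ j, Measurable[F] (N j)) ∧
      Tendsto (fun j => ν (U ∩ {ω | ω ∈ A (N j ω)})) atTop (𝓝 0)

/-- This upgrades smallness along random indices to uniform smallness on subsets of some `A n`. For
a set `U` nearly maximising `ν` and `E = {ω ∈ A_{N(ω)}}` with `ν(U ∩ E)` small, replacing `U ∩ E` by
any `B ⊆ E` cannot exceed the supremum, so `ν(B)` is small. For large `n`, a subset of `A n` lies in
`E` apart from its part in `{N > n}`, where `hbd` applies. -/
lemma exists_forall_subset_le [IsFiniteMeasure P] (hF : F ≤ mΩ) {ν : Set Ω → ℝ}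
    (hadd : ∀ A B, MeasurableSet A → MeasurableSet B → Disjoint A B → ν (A ∪ B) = ν A + ν B)
    (hbd : ∀ A C, MeasurableSet A → MeasurableSet[F] C → |ν (A ∩ C)| ≤ P.real C)
    (hcont : RandomIndexContinuous F ν) {A : ℕ → Set Ω} (hA : ∀ n, MeasurableSet (A n))
    (hanti : Antitone A) (hempty : ⋂ n, A n = ∅) {ε : ℝ} (hε : 0 < ε) :
    ∃ n, ∀ B, MeasurableSet B → B ⊆ A n → ν B ≤ ε := by
  let V : Set ℝ := {r | ∃ B, MeasurableSet B ∧ r = ν B}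
  have hV : BddAbove V := ⟨P.real univ, by
    rintro _ ⟨B, hB, rfl⟩
    have := hbd B univ hB MeasurableSet.univ
    rw [inter_univ] at this
    exact (le_abs_self _).trans this⟩
  have hVne : V.Nonempty := ⟨_, ∅, MeasurableSet.empty, rfl⟩
  obtain ⟨_, ⟨U, hU, rfl⟩, hUs⟩ := exists_lt_of_lt_csSup hVne
    (show sSup V - ε / 4 < sSup V by linarith)
  obtain ⟨N, hN, hlim⟩ := hcont U A hU hA hanti hempty
  obtain ⟨j, hj⟩ := (hlim.eventually (gt_mem_nhds (show (0 : ℝ) < ε / 4 by linarith))).exists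
  set E : Set Ω := {ω | ω ∈ A (N j ω)}
  have hE : MeasurableSet E := by
    have : E = ⋃ k, N j ⁻¹' {k} ∩ A k := by
      ext ω
      simp [E]
    rw [this]
    exact MeasurableSet.iUnion fun k =>
      (hF _ (hN j (measurableSet_singleton k))).inter (hA k)
  -- One `ε / 4` is the defect of `U` from the supremum, the other bounds `ν(U ∩ E)`.
  have hEB : ∀ B, MeasurableSet B → B ⊆ E → ν B ≤ ε / 2 := fun B hB hBE => by
    have h1 : ν (B ∪ U \ E) = ν B + ν (U \ E) := hadd _ _ hB (hU.diff hE)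
      (disjoint_left.2 fun ω h1 h2 => h2.2 (hBE h1))
    have h2 : ν (U ∩ E ∪ U \ E) = ν (U ∩ E) + ν (U \ E) := hadd _ _ (hU.inter hE) (hU.diff hE)
      (disjoint_left.2 fun ω h1 h2 => h2.2 h1.2)
    rw [inter_union_sdiff] at h2
    have h3 : ν (B ∪ U \ E) ≤ sSup V := le_csSup hV ⟨_, hB.union (hU.diff hE), rfl⟩
    linarith
  have hC : ∀ n, MeasurableSet[F] (N j ⁻¹' Ioi n) := fun n => hN j measurableSet_Ioi
  have hlim2 := tendsto_measure_iInter_atTop (μ := P) (s := fun n => N j ⁻¹' Ioi n)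
    (fun n => (hF _ (hC n)).nullMeasurableSet)
    (fun m n hmn => preimage_mono (Ioi_subset_Ioi hmn)) ⟨0, measure_ne_top _ _⟩
  have hz : ⋂ n, N j ⁻¹' Ioi n = ∅ := eq_empty_of_forall_notMem fun ω hω =>
    lt_irrefl (N j ω) (mem_iInter.1 hω (N j ω))
  rw [hz, measure_empty] at hlim2
  obtain ⟨n, hn⟩ := (hlim2.eventually (gt_mem_nhds
    (ENNReal.ofReal_pos.2 (show (0 : ℝ) < ε / 2 by linarith)))).exists
  have hn' : P.real (N j ⁻¹' Ioi n) ≤ ε / 2 :=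
    ENNReal.toReal_le_of_le_ofReal (by linarith) hn.le
  refine ⟨n, fun B hB hBA => ?_⟩
  have hCm : MeasurableSet (N j ⁻¹' Ioi n) := hF _ (hC n)
  have h1 := hadd (B ∩ N j ⁻¹' Ioi n) (B \ N j ⁻¹' Ioi n) (hB.inter hCm) (hB.diff hCm)
    (disjoint_left.2 fun ω h1 h2 => h2.2 h1.2)
  rw [inter_union_sdiff] at h1
  have h2 := hEB (B \ N j ⁻¹' Ioi n) (hB.diff hCm) fun ω hω =>
    hanti (not_lt.1 hω.2) (hBA hω.1)
  have h3 := (le_abs_self _).trans (hbd B _ hB (hC n))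
  linarith

-- The previous lemma for `ν` and `-ν` gives continuity at `∅`, so `ν` is a signed measure
-- absolutely continuous with respect to `P`, and Radon–Nikodym applies.
open Classical in
lemma exists_density [IsFiniteMeasure P] (hF : F ≤ mΩ) {ν : Set Ω → ℝ}
    (hadd : ∀ A B, MeasurableSet A → MeasurableSet B → Disjoint A B → ν (A ∪ B) = ν A + ν B)
    (hbd : ∀ A C, MeasurableSet A → MeasurableSet[F] C → |ν (A ∩ C)| ≤ P.real C)
    (hnull : ∀ A, MeasurableSet A → P A = 0 → ν A = 0)
    (hcont : RandomIndexContinuous F ν) :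
    ∃ g : Ω → ℝ, Measurable g ∧ Integrable g P ∧
      ∀ A, MeasurableSet A → ν A = ∫ ω in A, g ω ∂P := by
  have hempty : ν ∅ = 0 := hnull ∅ MeasurableSet.empty measure_empty
  have hsmall : ∀ A : ℕ → Set Ω, (∀ n, MeasurableSet (A n)) → Antitone A → ⋂ n, A n = ∅ →
      ∀ ε > 0, ∃ n, ∀ B, MeasurableSet B → B ⊆ A n → |ν B| ≤ ε := by
    intro A hA hanti he ε hε
    obtain ⟨n, hn⟩ := exists_forall_subset_le hF hadd hbd hcont hA hanti he hε
    obtain ⟨m, hm⟩ := exists_forall_subset_le (P := P) hF (ν := fun A => -ν A)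
      (fun A B hA hB h => by rw [hadd A B hA hB h]; ring)
      (fun A C hA hC => by rw [abs_neg]; exact hbd A C hA hC)
      (fun U A hU hA h h' => by
        obtain ⟨N, hN, hl⟩ := hcont U A hU hA h h'
        exact ⟨N, hN, by simpa using hl.neg⟩) hA hanti he hε
    refine ⟨max n m, fun B hB hBA => abs_le.2 ⟨?_, ?_⟩⟩
    · linarith [hm B hB (hBA.trans (hanti (le_max_right _ _)))]
    · exact hn B hB (hBA.trans (hanti (le_max_left _ _)))
  have hfin : ∀ (A : ℕ → Set Ω), (∀ i, MeasurableSet (A i)) → Pairwise (Function.onFun Disjoint A) →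
      ∀ s : Finset ℕ, ν (⋃ i ∈ s, A i) = ∑ i ∈ s, ν (A i) := by
    intro A hA hd s
    induction s using Finset.induction_on with
    | empty => simp [hempty]
    | insert a s ha ih =>
      rw [Finset.set_biUnion_insert, Finset.sum_insert ha, ← ih]
      refine hadd _ _ (hA a) (s.measurableSet_biUnion fun i _ => hA i) ?_
      refine disjoint_iUnion₂_right.2 fun i hi => hd fun h => ha (h ▸ hi)
  let κ : SignedMeasure Ω :=
    { measureOf' := fun A => if MeasurableSet A then ν A else 0
      empty' := by simp [hempty]
      not_measurable' := fun A hA => if_neg hA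
      m_iUnion' := by
        intro A hA hd
        simp only [hA, if_true, MeasurableSet.iUnion hA]
        rw [HasSum, SummationFilter.unconditional_filter, Metric.tendsto_atTop]
        intro ε hε
        have hT : ∀ n, MeasurableSet (⋃ i ≥ n, A i) := fun n =>
          MeasurableSet.iUnion fun i => MeasurableSet.iUnion fun _ => hA i
        -- The tails of a disjoint sequence decrease to `∅`, and what a large finite partial union
        -- omits is contained in a tail.
        obtain ⟨n, hn⟩ := hsmall (fun n => ⋃ i ≥ n, A i) hT
          (fun m n hmn => biUnion_subset_biUnion_left fun i hi => le_trans hmn hi) (by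
            refine eq_empty_of_forall_notMem fun ω hω => ?_
            obtain ⟨i, -, hi⟩ := mem_iUnion₂.1 (mem_iInter.1 hω 0)
            obtain ⟨j, hj, hj'⟩ := mem_iUnion₂.1 (mem_iInter.1 hω (i + 1))
            exact disjoint_left.1 (hd (show i ≠ j by have : j ≥ i + 1 := hj; omega)) hi hj')
          (ε / 2) (by linarith)
        refine ⟨Finset.range n, fun s hs => ?_⟩
        rw [← hfin A hA hd s, dist_comm, Real.dist_eq]
        have hsm : MeasurableSet (⋃ i ∈ s, A i) := s.measurableSet_biUnion fun i _ => hA i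
        have hsub : ⋃ i ∈ s, A i ⊆ ⋃ i, A i := iUnion₂_subset fun i _ => subset_iUnion A i
        have h1 := hadd _ _ hsm ((MeasurableSet.iUnion hA).diff hsm) disjoint_sdiff_right
        rw [union_sdiff_cancel hsub] at h1
        rw [h1, add_sub_cancel_left]
        refine lt_of_le_of_lt (hn _ ((MeasurableSet.iUnion hA).diff hsm) fun ω hω => ?_)
          (half_lt_self hε)
        obtain ⟨i, hi⟩ := mem_iUnion.1 hω.1
        refine mem_iUnion₂.2 ⟨i, ?_, hi⟩
        by_contra hlt
        exact hω.2 (mem_iUnion₂.2 ⟨i, hs (Finset.mem_range.2 (not_le.1 hlt)), hi⟩) }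
  have hκ : ∀ A, MeasurableSet A → κ A = ν A := fun A hA => if_pos hA
  have hac : κ ≪ᵥ P.toENNRealVectorMeasure := by
    refine VectorMeasure.AbsolutelyContinuous.mk fun A hA h => ?_
    rw [Measure.toENNRealVectorMeasure_apply_measurable hA] at h
    rw [hκ A hA, hnull A hA h]
  have hrn := κ.withDensityᵥ_rnDeriv_eq P hac
  refine ⟨κ.rnDeriv P, κ.measurable_rnDeriv P, κ.integrable_rnDeriv P, fun A hA => ?_⟩
  rw [← hκ A hA, ← withDensityᵥ_apply (κ.integrable_rnDeriv P) hA, hrn]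

end CondOrlicz

end

noncomputable section

namespace CondOrlicz

variable {Ω : Type*} {F : MeasurableSpace Ω} [mΩ : MeasurableSpace Ω] {P : Measure Ω}
  {φ : ℝ≥0 → ℝ≥0∞}

/-! ### Representation of conditionally order continuous functionals -/

lemma IsOrderBounded.exists_ae_bound {hφ : IsYoung φ} {f : orlicz F P hφ → L0F F P}
    (hf : IsOrderBounded hφ f) (x : orlicz F P hφ) : ∃ w, IsWeight F w ∧
      ∀ z : orlicz F P hφ, (∀ᵐ ω ∂P, |(z : Ω →ₘ[P] ℝ) ω| ≤ |(x : Ω →ₘ[P] ℝ) ω|) →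
        ∀ᵐ ω ∂P, |(w ω : ℝ) * (f z : Ω →ₘ[P] ℝ) ω| ≤ 1 := by
  obtain ⟨y, hy0, hy⟩ := hf x
  obtain ⟨b, hb, hyb⟩ := exists_measurable_rep y
  have hw : IsWeight F fun ω => (1 + ‖b ω‖₊)⁻¹ := .inv_one_add (measurable_nnnorm.comp hb)
  refine ⟨_, hw, fun z hz => ?_⟩
  have hzI : (z : Ω →ₘ[P] ℝ) ∈ Icc (-|(x : Ω →ₘ[P] ℝ)|) |(x : Ω →ₘ[P] ℝ)| := by
    refine mem_Icc_of_ae_abs_le ?_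
    filter_upwards [hz, AEEqFun.coeFn_abs (x : Ω →ₘ[P] ℝ)] with ω h1 h2
    rwa [h2]
  have h := hy z hzI
  filter_upwards [AEEqFun.coeFn_le.2 h.1, AEEqFun.coeFn_le.2 h.2, hyb,
    AEEqFun.coeFn_neg (y : Ω →ₘ[P] ℝ)] with ω h1 h2 h3 h4
  rw [h4, Pi.neg_apply, h3] at h1
  rw [h3] at h2
  have h5 : |(f z : Ω →ₘ[P] ℝ) ω| ≤ 1 + ‖b ω‖ := (abs_le.2 ⟨h1, h2⟩).trans
    ((le_abs_self _).trans (by rw [Real.norm_eq_abs]; linarith))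
  rw [abs_mul, NNReal.abs_eq, NNReal.coe_inv, NNReal.coe_add, NNReal.coe_one, coe_nnnorm,
    inv_mul_le_iff₀ (by positivity), mul_one]
  exact h5

lemma indElem_add [IsFiniteMeasure P] (hF : F ≤ mΩ) (hφ : IsYoung φ) {A B : Set Ω}
    (hA : MeasurableSet A) (hB : MeasurableSet B) (hd : Disjoint A B) :
    (indElem hF hφ (A ∪ B) (hA.union hB) : orlicz F P hφ) =
      indElem hF hφ A hA + indElem hF hφ B hB := by
  refine orlicz_ext ?_
  rw [Submodule.coe_add]
  filter_upwards [coeFn_indElem (P := P) hF hφ (hA.union hB), coeFn_indElem (P := P) hF hφ hA,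
    coeFn_indElem (P := P) hF hφ hB, AEEqFun.coeFn_add
      (indElem hF hφ A hA : orlicz F P hφ).1 (indElem hF hφ B hB : orlicz F P hφ).1]
    with ω h1 h2 h3 h4
  rw [h1, h4, Pi.add_apply, h2, h3, indicator_union_of_disjoint hd]

/-- The set function is `ν(A) = ∫ w f(1_A)`, where `w` normalises `f` on the order interval of the
constant `1`. -/
lemma exists_density_of_mem_orderDual [IsFiniteMeasure P] (hF : F ≤ mΩ) {hφ : IsYoung φ}
    {f : orlicz F P hφ → L0F F P} (hf : f ∈ orderDual hF hφ) :
    ∃ (w : Ω → ℝ≥0) (g : Ω → ℝ), IsWeight F w ∧ Measurable g ∧ Integrable g P ∧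
      ∀ A (hA : MeasurableSet A),
        Integrable (fun ω => (w ω : ℝ) * (f (indElem hF hφ A hA) : Ω →ₘ[P] ℝ) ω) P ∧
        ∫ ω, (w ω : ℝ) * (f (indElem hF hφ A hA) : Ω →ₘ[P] ℝ) ω ∂P = ∫ ω in A, g ω ∂P := by
  have hlin := hf.1.2
  obtain ⟨w, hw, hbound⟩ := hf.2.1.exists_ae_bound (indElem hF hφ univ MeasurableSet.univ)
  have hwm : Measurable fun ω => (w ω : ℝ) := (hw.measurable hF).coe_nnreal_real
  have hb : ∀ A (hA : MeasurableSet A),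
      ∀ᵐ ω ∂P, |(w ω : ℝ) * (f (indElem hF hφ A hA) : Ω →ₘ[P] ℝ) ω| ≤ 1 := fun A hA => by
    refine hbound _ ?_
    filter_upwards [coeFn_indElem (P := P) hF hφ hA,
      coeFn_indElem (P := P) hF hφ MeasurableSet.univ] with ω h1 h2
    rw [h1, h2]
    by_cases h : ω ∈ A <;> simp [h]
  have hmeas : ∀ A (hA : MeasurableSet A), AEStronglyMeasurable
      (fun ω => (w ω : ℝ) * (f (indElem hF hφ A hA) : Ω →ₘ[P] ℝ) ω) P := fun A hA =>
    (hwm.mul (f (indElem hF hφ A hA) : Ω →ₘ[P] ℝ).measurable).aestronglyMeasurable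
  have hinteg : ∀ A (hA : MeasurableSet A),
      Integrable (fun ω => (w ω : ℝ) * (f (indElem hF hφ A hA) : Ω →ₘ[P] ℝ) ω) P :=
    fun A hA => Integrable.of_bound (hmeas A hA) 1 (hb A hA)
  classical
  let ν : Set Ω → ℝ := fun A => if hA : MeasurableSet A then
    ∫ ω, (w ω : ℝ) * (f (indElem hF hφ A hA) : Ω →ₘ[P] ℝ) ω ∂P else 0
  have hν : ∀ A (hA : MeasurableSet A), ν A =
    ∫ ω, (w ω : ℝ) * (f (indElem hF hφ A hA) : Ω →ₘ[P] ℝ) ω ∂P := fun A hA => dif_pos hA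
  refine Exists.elim (exists_density (P := P) hF (ν := ν) ?_ ?_ ?_ ?_) fun g ⟨hg, hgi, hgν⟩ =>
    ⟨w, g, hw, hg, hgi, fun A hA => ⟨hinteg A hA, by rw [← hν A hA, hgν A hA]⟩⟩
  · intro A B hA hB hd
    rw [hν A hA, hν B hB, hν _ (hA.union hB), ← integral_add (hinteg A hA) (hinteg B hB)]
    refine integral_congr_ae ?_
    rw [indElem_add hF hφ hA hB hd, hlin.map_add]
    filter_upwards [AEEqFun.coeFn_add (f (indElem hF hφ A hA) : Ω →ₘ[P] ℝ)
      (f (indElem hF hφ B hB))] with ω h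
    rw [Subring.coe_add, h, Pi.add_apply, mul_add]
  -- By locality `f(1_{A ∩ C})` vanishes off `C`, so only `C` contributes, with integrand at most
  -- `1`.
  · intro A C hA hC
    have hAC := hA.inter (hF _ hC)
    rw [hν _ hAC]
    have h1 := map_eqOn hF hlin hC.compl (x := indElem hF hφ _ hAC) (x' := 0) (by
      filter_upwards [coeFn_indElem (P := P) hF hφ hAC,
        AEEqFun.coeFn_zero (μ := P) (α := Ω) (β := ℝ)] with ω h1 h2 hω
      rw [h1, Submodule.coe_zero, h2, indicator_of_notMem fun h => hω h.2, Pi.zero_apply])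
    rw [← Real.norm_eq_abs]
    have h2 : ∫ ω, (w ω : ℝ) * (f (indElem hF hφ _ hAC) : Ω →ₘ[P] ℝ) ω ∂P =
        ∫ ω in C, (w ω : ℝ) * (f (indElem hF hφ _ hAC) : Ω →ₘ[P] ℝ) ω ∂P := by
      rw [← integral_indicator (hF _ hC)]
      refine integral_congr_ae ?_
      filter_upwards [h1, AEEqFun.coeFn_zero (μ := P) (α := Ω) (β := ℝ)] with ω h1 h2
      by_cases hω : ω ∈ C
      · rw [indicator_of_mem hω]
      · rw [indicator_of_notMem hω, h1 hω, hlin.map_zero, Subring.coe_zero, h2, Pi.zero_apply,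
          mul_zero]
    rw [h2]
    refine (norm_setIntegral_le_of_norm_le_const_ae (C := 1) (measure_lt_top _ _) ?_).trans
      (one_mul _).le
    exact ae_restrict_of_ae (hb _ hAC)
  · intro A hA h0
    rw [hν A hA]
    have : (indElem hF hφ A hA : orlicz F P hφ) = 0 := by
      refine orlicz_ext ?_
      filter_upwards [coeFn_indElem (P := P) hF hφ hA, measure_eq_zero_iff_ae_notMem.1 h0,
        AEEqFun.coeFn_zero (μ := P) (α := Ω) (β := ℝ)] with ω h1 h2 h3
      rw [h1, Submodule.coe_zero, h3, indicator_of_notMem h2, Pi.zero_apply]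
    rw [this, hlin.map_zero]
    refine integral_eq_zero_of_ae ?_
    filter_upwards [AEEqFun.coeFn_zero (μ := P) (α := Ω) (β := ℝ)] with ω h
    rw [Subring.coe_zero, h, Pi.zero_apply, mul_zero]
  · intro U A hU hA hanti hempty
    have hd : ∀ᵐ ω ∂P, ∀ n, ((indElem hF hφ _ (hU.inter (hA n)) : orlicz F P hφ) : Ω →ₘ[P] ℝ) ω =
        (U ∩ A n).indicator (fun _ => (1 : ℝ)) ω :=
      ae_all_iff.2 fun n => coeFn_indElem (P := P) hF hφ (hU.inter (hA n))
    obtain ⟨N, D, hN, -, hDN, hlim⟩ := exists_randomIndex_tendsto_zero hF hf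
      (fun n => indElem hF hφ _ (hU.inter (hA n))) (by
        filter_upwards [hd] with ω h n
        rw [h n]
        exact indicator_nonneg (fun _ _ => zero_le_one) _) (by
        filter_upwards [hd] with ω h m n hmn
        simp only [h]
        exact indicator_le_indicator_of_subset (inter_subset_inter_right _ (hanti hmn))
          (fun _ => zero_le_one) _) (by
        filter_upwards [hd] with ω h
        simp only [h]
        have : ω ∉ ⋂ n, A n := by rw [hempty]; exact notMem_empty ω
        simp only [mem_iInter, not_forall] at this
        obtain ⟨k, hk⟩ := this
        refine tendsto_const_nhds.congr' ?_
        filter_upwards [eventually_ge_atTop k] with n hn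
        rw [indicator_of_notMem fun h => hk (hanti hn h.2)]) 0
    refine ⟨N, hN, ?_⟩
    have hE : ∀ j, MeasurableSet (U ∩ {ω | ω ∈ A (N j ω)}) := fun j => by
      have : {ω | ω ∈ A (N j ω)} = ⋃ k, N j ⁻¹' {k} ∩ A k := by
        ext ω
        simp
      rw [this]
      exact hU.inter (MeasurableSet.iUnion fun k =>
        (hF _ (hN j (measurableSet_singleton k))).inter (hA k))
    -- Selecting `1_{U ∩ A n}` at a random index again gives an indicator, so dominated convergence
    -- applies to `ν`.
    have hDE : ∀ j, D j = indElem hF hφ _ (hE j) := fun j => by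
      refine orlicz_ext ?_
      filter_upwards [hDN j, coeFn_indElem (P := P) hF hφ (hE j), hd] with ω h1 h2 h3
      rw [h1, h2, h3]
      by_cases hω : ω ∈ U ∩ A (N j ω)
      · rw [indicator_of_mem hω, indicator_of_mem (by exact hω)]
      · rw [indicator_of_notMem hω, indicator_of_notMem (by exact hω)]
    simp only [hν _ (hE _)]
    have key := tendsto_integral_of_dominated_convergence (μ := P) (f := fun _ => (0 : ℝ))
      (F := fun j ω => (w ω : ℝ) * (f (indElem hF hφ _ (hE j)) : Ω →ₘ[P] ℝ) ω) (fun _ => 1)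
      (fun j => hmeas _ (hE j)) (integrable_const _) (fun j => hb _ (hE j)) (by
        filter_upwards [hlim] with ω h
        simp only [hDE] at h
        simpa using h.const_mul (w ω : ℝ))
    simpa using key

/-- The density represents the functional on indicator functions. -/
lemma exists_eq_muFun_indElem [IsFiniteMeasure P] (hF : F ≤ mΩ) {hφ : IsYoung φ}
    {f : orlicz F P hφ → L0F F P} (hf : f ∈ orderDual hF hφ) :
    ∃ y : Ω →ₘ[P] ℝ, y ∈ L1F F P ∧ ∀ A (hA : MeasurableSet A),
      f (indElem hF hφ A hA) = muFun F P hφ y (indElem hF hφ A hA) := by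
  obtain ⟨w, g, hw, hg, hgi, h⟩ := exists_density_of_mem_orderDual hF hf
  have hlin := hf.1.2
  have hwm : Measurable fun ω => (w ω : ℝ) := (hw.measurable hF).coe_nnreal_real
  have hy : Measurable fun ω => (w ω : ℝ)⁻¹ * g ω := hwm.inv.mul hg
  have hyc := AEEqFun.coeFn_mk _ (hy.aestronglyMeasurable (μ := P))
  set y : Ω →ₘ[P] ℝ := AEEqFun.mk _ hy.aestronglyMeasurable
  have hw0 : ∀ ω, (w ω : ℝ) ≠ 0 := fun ω => NNReal.coe_ne_zero.2 (hw.pos ω).ne'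
  refine ⟨y, (mem_L1F_iff hF).2 ⟨w, hw, hgi.congr ?_⟩, fun A hA => ?_⟩
  · filter_upwards [hyc] with ω h1
    rw [h1, mul_inv_cancel_left₀ (hw0 ω)]
  have e : (fun ω => (w ω : ℝ) * ((indElem hF hφ A hA : orlicz F P hφ) * y : Ω →ₘ[P] ℝ) ω)
      =ᵐ[P] A.indicator g := by
    filter_upwards [hyc, coeFn_indElem (P := P) hF hφ hA,
      AEEqFun.coeFn_mul (indElem hF hφ A hA : orlicz F P hφ).1 y] with ω h1 h2 h3
    rw [h3, Pi.mul_apply, h1, h2]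
    by_cases hω : ω ∈ A
    · rw [indicator_of_mem hω, indicator_of_mem hω, one_mul, mul_inv_cancel_left₀ (hw0 ω)]
    · simp [hω]
  have hiA := hgi.indicator hA
  refine (condE_eq_of_weight hF hw (hiA.congr e.symm) ?_).symm
  refine (EventuallyEq.trans ?_ (condExp_congr_ae e.symm))
  -- For `s` in `F`, locality turns `∫_s w f(1_A)` into `∫ w f(1_{A ∩ s})`, which is the integral of
  -- `g` over `A ∩ s`.
  refine ae_eq_condExp_of_forall_setIntegral_eq hF hiA (fun s _ _ => (h A hA).1.integrableOn)
    (fun s hs _ => ?_) ?_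
  · have hAs := hA.inter (hF s hs)
    rw [setIntegral_indicator hA, inter_comm s A, ← (h _ hAs).2, ← integral_indicator (hF s hs)]
    refine integral_congr_ae ?_
    have h1 := map_eqOn hF hlin hs (x := indElem hF hφ _ hA) (x' := indElem hF hφ _ hAs) (by
      filter_upwards [coeFn_indElem (P := P) hF hφ hA, coeFn_indElem (P := P) hF hφ hAs]
        with ω h1 h2 hω
      rw [h1, h2]
      by_cases hA' : ω ∈ A <;> simp [hA', hω])
    have h2 := map_eqOn hF hlin hs.compl (x := indElem hF hφ _ hAs) (x' := 0) (by
      filter_upwards [coeFn_indElem (P := P) hF hφ hAs,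
        AEEqFun.coeFn_zero (μ := P) (α := Ω) (β := ℝ)] with ω h1 h2 hω
      rw [h1, Submodule.coe_zero, h2, indicator_of_notMem fun h => hω h.2, Pi.zero_apply])
    filter_upwards [h1, h2, AEEqFun.coeFn_zero (μ := P) (α := Ω) (β := ℝ)] with ω h1 h2 h3
    by_cases hω : ω ∈ s
    · rw [indicator_of_mem hω, h1 hω]
    · rw [indicator_of_notMem hω, h2 hω, hlin.map_zero, Subring.coe_zero, h3, Pi.zero_apply,
        mul_zero]
  · exact hw.meas.coe_nnreal_real.stronglyMeasurable.aestronglyMeasurable.mul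
      (f (indElem hF hφ A hA)).2

end CondOrlicz

end

noncomputable section

namespace CondOrlicz

variable {Ω : Type*} {F : MeasurableSpace Ω} [mΩ : MeasurableSpace Ω] {P : Measure Ω}
  {φ : ℝ≥0 → ℝ≥0∞}

/-! ### Extension from indicator functions to the whole module -/

lemma integrable_weight_mul_mul {w : Ω → ℝ≥0} {x y : Ω →ₘ[P] ℝ}
    (hy : Integrable (fun ω => (w ω : ℝ) * y ω) P) {C : ℝ} (hx : ∀ᵐ ω ∂P, |x ω| ≤ C) :
    Integrable (fun ω => (w ω : ℝ) * (x * y) ω) P := by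
  refine (hy.bdd_mul x.measurable.aestronglyMeasurable hx).congr ?_
  filter_upwards [AEEqFun.coeFn_mul x y] with ω h
  rw [h, Pi.mul_apply]
  ring

lemma mul_mem_L1F_of_bounded [IsFiniteMeasure P] (hF : F ≤ mΩ) {x y : Ω →ₘ[P] ℝ}
    (hy : y ∈ L1F F P) {C : ℝ} (hx : ∀ᵐ ω ∂P, |x ω| ≤ C) : x * y ∈ L1F F P := by
  obtain ⟨w, hw, hi⟩ := (mem_L1F_iff hF).1 hy
  exact (mem_L1F_iff hF).2 ⟨w, hw, integrable_weight_mul_mul hi hx⟩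

lemma exists_simpleElem [IsFiniteMeasure P] (hF : F ≤ mΩ) (hφ : IsYoung φ) (s : SimpleFunc Ω ℝ) :
    ∃ x : orlicz F P hφ, (x : Ω →ₘ[P] ℝ) =ᵐ[P] s := by
  obtain ⟨C, hC⟩ := s.exists_forall_norm_le
  exact ⟨bddElem hF hφ s s.measurable C.toNNReal fun ω => (hC ω).trans (Real.le_coe_toNNReal C),
    coeFn_bddElem hF hφ _ _⟩

lemma ae_abs_le_of_simple {s : SimpleFunc Ω ℝ} {x : Ω →ₘ[P] ℝ} (hx : x =ᵐ[P] s) :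
    ∃ C : ℝ, ∀ᵐ ω ∂P, |x ω| ≤ C := by
  obtain ⟨C, hC⟩ := s.exists_forall_norm_le
  refine ⟨C, ?_⟩
  filter_upwards [hx] with ω h
  rw [h]
  exact hC ω

/-- At this stage only `y ∈ L¹_F` is known, so additivity of `condE` is available through
boundedness of simple functions. -/
lemma eq_muFun_of_simple [IsFiniteMeasure P] (hF : F ≤ mΩ) {hφ : IsYoung φ}
    {f : orlicz F P hφ → L0F F P} (hlin : IsLinearMap (L0F F P) f) {y : Ω →ₘ[P] ℝ}
    (hy : y ∈ L1F F P) (h : ∀ A (hA : MeasurableSet A),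
      f (indElem hF hφ A hA) = muFun F P hφ y (indElem hF hφ A hA))
    (s : SimpleFunc Ω ℝ) :
    ∀ x : orlicz F P hφ, (x : Ω →ₘ[P] ℝ) =ᵐ[P] s → f x = muFun F P hφ y x := by
  induction s using SimpleFunc.induction with
  | const c hA =>
    rename_i A
    intro x hx
    have ec := coeFn_toL0F (P := P) hF (fun _ => c) measurable_const
    have e : x = (toL0F hF (fun _ => c) measurable_const : L0F F P) • indElem hF hφ A hA := by
      refine orlicz_ext ?_
      rw [Submodule.coe_smul, Subring.smul_def, smul_eq_mul]
      filter_upwards [hx, ec, coeFn_indElem (P := P) hF hφ hA, AEEqFun.coeFn_mul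
        (toL0F (P := P) hF (fun _ => c) measurable_const : Ω →ₘ[P] ℝ)
        (indElem hF hφ A hA : orlicz F P hφ).1] with ω h1 h2 h3 h4
      rw [h1, h4, Pi.mul_apply, h2, h3]
      by_cases hω : ω ∈ A <;> simp [hω]
    obtain ⟨C, hC⟩ : ∃ C : ℝ, ∀ᵐ ω ∂P, |(indElem hF hφ A hA : orlicz F P hφ).1 ω| ≤ C := by
      refine ⟨1, ?_⟩
      filter_upwards [coeFn_indElem (P := P) hF hφ hA] with ω h1
      rw [h1]
      exact abs_indicator_one_le A ω
    rw [e, hlin.map_smul, h A hA]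
    simp only [muFun, Submodule.coe_smul, Subring.smul_def, smul_eq_mul, mul_assoc]
    exact (condE_mul hF (mul_mem_L1F_of_bounded hF hy hC) _).symm
  | add hd h1 h2 =>
    rename_i s t
    intro x hx
    obtain ⟨a, ha⟩ := exists_simpleElem (P := P) hF hφ s
    obtain ⟨b, hb⟩ := exists_simpleElem (P := P) hF hφ t
    obtain ⟨C, hC⟩ := ae_abs_le_of_simple ha
    obtain ⟨C', hC'⟩ := ae_abs_le_of_simple hb
    have e : x = a + b := by
      refine orlicz_ext ?_
      rw [Submodule.coe_add]
      filter_upwards [hx, ha, hb, AEEqFun.coeFn_add a.1 b.1] with ω h1 h2 h3 h4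
      rw [h1, h4, Pi.add_apply, h2, h3, SimpleFunc.coe_add, Pi.add_apply]
    rw [e, hlin.map_add, h1 a ha, h2 b hb]
    simp only [muFun, Submodule.coe_add, add_mul]
    exact (condE_add hF (mul_mem_L1F_of_bounded hF hy hC) (mul_mem_L1F_of_bounded hF hy hC')).symm

lemma exists_simple_approx {x : Ω → ℝ} (hx : Measurable x) :
    ∃ s : ℕ → SimpleFunc Ω ℝ, (∀ n ω, 0 ≤ s n ω) ∧ (∀ ω, Monotone fun n => s n ω) ∧
      ∀ ω, 0 ≤ x ω → (∀ n, s n ω ≤ x ω) ∧ Tendsto (fun n => s n ω) atTop (𝓝 (x ω)) := by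
  have hm : Measurable fun ω => ENNReal.ofReal (x ω) := hx.ennreal_ofReal
  refine ⟨fun n => (SimpleFunc.eapprox (fun ω => ENNReal.ofReal (x ω)) n).map ENNReal.toReal,
    fun n ω => ENNReal.toReal_nonneg, fun ω m n hmn => ?_, fun ω h0 => ⟨fun n => ?_, ?_⟩⟩
  · exact ENNReal.toReal_mono (SimpleFunc.eapprox_lt_top _ n ω).ne
      (SimpleFunc.monotone_eapprox _ hmn ω)
  · have h1 := (le_iSup (fun n => SimpleFunc.eapprox (fun ω => ENNReal.ofReal (x ω)) n ω) n).trans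
      (SimpleFunc.iSup_eapprox_apply hm ω).le
    exact ENNReal.toReal_le_of_le_ofReal h0 h1
  · have h1 := (ENNReal.tendsto_toReal ENNReal.ofReal_ne_top).comp
      (SimpleFunc.tendsto_eapprox hm ω)
    rwa [ENNReal.toReal_ofReal h0] at h1

/-- Let simple `s n` increase to `|x|`. Cutting `s n` along the sign of `y` gives two elements of
the order interval of `x`, where the weighted `f` is at most `1`; so the weighted integrals of `s n
|y|` are bounded by `2 P(Ω)`, and monotone convergence concludes. -/
lemma mul_mem_L1F_of_eq_muFun [IsFiniteMeasure P] (hF : F ≤ mΩ) {hφ : IsYoung φ}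
    {f : orlicz F P hφ → L0F F P} (hbdd : IsOrderBounded hφ f) {y : Ω →ₘ[P] ℝ}
    (hy : y ∈ L1F F P) (h : ∀ s : SimpleFunc Ω ℝ, ∀ x : orlicz F P hφ,
      (x : Ω →ₘ[P] ℝ) =ᵐ[P] s → f x = muFun F P hφ y x) (x : orlicz F P hφ) :
    (x : Ω →ₘ[P] ℝ) * y ∈ L1F F P := by
  obtain ⟨w, hw, hbound⟩ := hbdd.exists_ae_bound x
  obtain ⟨v, hv, hvy⟩ := (mem_L1F_iff hF).1 hy
  have hW := hw.min hv
  have hWm : Measurable fun ω => ((min (w ω) (v ω) : ℝ≥0) : ℝ) :=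
    (hW.measurable hF).coe_nnreal_real
  have hWy := hW.integrable_of_le hF hvy (fun _ => min_le_right _ _) (ae_of_all _ fun _ => le_rfl)
  obtain ⟨s, hs0, hsm, hsx⟩ := exists_simple_approx (x := fun ω => |(x : Ω →ₘ[P] ℝ) ω|)
    (continuous_abs.measurable.comp (x : Ω →ₘ[P] ℝ).measurable)
  have hle : ∀ n ω, s n ω ≤ |(x : Ω →ₘ[P] ℝ) ω| := fun n ω => (hsx ω (abs_nonneg _)).1 n
  -- the integral of the weighted product over a measurable set is controlled by the functional
  have key : ∀ n (A : Set Ω), MeasurableSet A →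
      Integrable (fun ω => ((min (w ω) (v ω) : ℝ≥0) : ℝ) * (A.indicator (s n) ω * y ω)) P ∧
      |∫ ω, ((min (w ω) (v ω) : ℝ≥0) : ℝ) * (A.indicator (s n) ω * y ω) ∂P| ≤ P.real univ := by
    intro n A hA
    obtain ⟨a, ha⟩ := exists_simpleElem (P := P) hF hφ ((s n).restrict A)
    obtain ⟨C, hC⟩ := ae_abs_le_of_simple ha
    have hi := integrable_weight_mul_mul hWy hC
    have e : (fun ω => ((min (w ω) (v ω) : ℝ≥0) : ℝ) * ((a : Ω →ₘ[P] ℝ) * y) ω) =ᵐ[P]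
        fun ω => ((min (w ω) (v ω) : ℝ≥0) : ℝ) * (A.indicator (s n) ω * y ω) := by
      filter_upwards [ha, AEEqFun.coeFn_mul (a : Ω →ₘ[P] ℝ) y] with ω h1 h2
      rw [h2, Pi.mul_apply, h1, SimpleFunc.restrict_apply _ hA]
    refine ⟨hi.congr e, ?_⟩
    rw [← integral_congr_ae e, ← integral_weight_mul_condE hF hW hi, ← Real.norm_eq_abs]
    refine (norm_integral_le_of_norm_le_const (C := 1) ?_).trans (one_mul _).le
    have hfa : f a = condE F P ((a : Ω →ₘ[P] ℝ) * y) := h _ a ha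
    rw [← hfa]
    filter_upwards [hbound a (by
      filter_upwards [ha] with ω h1
      rw [h1, SimpleFunc.restrict_apply _ hA]
      by_cases hω : ω ∈ A
      · rw [indicator_of_mem hω, abs_of_nonneg (hs0 n ω)]
        exact hle n ω
      · simp [hω])] with ω h1
    rw [norm_mul, NNReal.norm_eq, Real.norm_eq_abs]
    rw [abs_mul, NNReal.abs_eq] at h1
    exact le_trans (mul_le_mul_of_nonneg_right (NNReal.coe_le_coe.2 (min_le_left _ _))
      (abs_nonneg _)) h1
  have hyA : MeasurableSet {ω | 0 ≤ y ω} := measurableSet_le measurable_const y.measurable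
  have hinteg : ∀ n, ∫⁻ ω, ENNReal.ofReal (((min (w ω) (v ω) : ℝ≥0) : ℝ) * (s n ω * |y ω|)) ∂P ≤
      ENNReal.ofReal (2 * P.real univ) := by
    intro n
    obtain ⟨i1, b1⟩ := key n _ hyA
    obtain ⟨i2, b2⟩ := key n _ hyA.compl
    have e : (fun ω => ((min (w ω) (v ω) : ℝ≥0) : ℝ) * (s n ω * |y ω|)) =
        fun ω => ((min (w ω) (v ω) : ℝ≥0) : ℝ) * ({ω | 0 ≤ y ω}.indicator (s n) ω * y ω) -
          ((min (w ω) (v ω) : ℝ≥0) : ℝ) * ({ω | 0 ≤ y ω}ᶜ.indicator (s n) ω * y ω) := by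
      ext ω
      by_cases hω : 0 ≤ y ω
      · rw [indicator_of_mem (show ω ∈ {ω | 0 ≤ y ω} from hω),
          indicator_of_notMem (fun h : ω ∈ {ω | 0 ≤ y ω}ᶜ => h hω), abs_of_nonneg hω]
        ring
      · rw [indicator_of_notMem (show ω ∉ {ω | 0 ≤ y ω} from hω),
          indicator_of_mem (show ω ∈ {ω | 0 ≤ y ω}ᶜ from hω), abs_of_neg (not_le.1 hω)]
        ring
    rw [← ofReal_integral_eq_lintegral_ofReal (e ▸ i1.sub i2)
      (ae_of_all _ fun ω => mul_nonneg (NNReal.coe_nonneg _)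
        (mul_nonneg (hs0 n ω) (abs_nonneg _)))]
    refine ENNReal.ofReal_le_ofReal ?_
    rw [e, integral_sub i1 i2]
    linarith [(abs_le.1 b1).2, (abs_le.1 b2).1]
  have hlim : Tendsto
      (fun n => ∫⁻ ω, ENNReal.ofReal (((min (w ω) (v ω) : ℝ≥0) : ℝ) * (s n ω * |y ω|)) ∂P) atTop
      (𝓝 (∫⁻ ω, ENNReal.ofReal (((min (w ω) (v ω) : ℝ≥0) : ℝ) *
        (|(x : Ω →ₘ[P] ℝ) ω| * |y ω|)) ∂P)) := by
    refine lintegral_tendsto_of_tendsto_of_monotone (fun n => (hWm.mul ((s n).measurable.mul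
      (continuous_abs.measurable.comp y.measurable))).ennreal_ofReal.aemeasurable)
      (ae_of_all _ fun ω m n hmn => ENNReal.ofReal_le_ofReal ?_) (ae_of_all _ fun ω => ?_)
    · exact mul_le_mul_of_nonneg_left (mul_le_mul_of_nonneg_right (hsm ω hmn) (abs_nonneg _))
        (NNReal.coe_nonneg _)
    · exact ENNReal.tendsto_ofReal
        ((((hsx ω (abs_nonneg _)).2).mul_const |y ω|).const_mul _)
  have hfin := lt_of_le_of_lt (le_of_tendsto' hlim hinteg) ENNReal.ofReal_lt_top
  refine (mem_L1F_iff hF).2 ⟨_, hW, (hWm.mul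
    ((x : Ω →ₘ[P] ℝ) * y).measurable).aestronglyMeasurable, ?_⟩
  refine lt_of_le_of_lt (lintegral_mono_ae ?_) hfin
  filter_upwards [AEEqFun.coeFn_mul (x : Ω →ₘ[P] ℝ) y] with ω h1
  rw [h1, Pi.mul_apply, ← ofReal_norm, norm_mul, norm_mul, NNReal.norm_eq, Real.norm_eq_abs,
    Real.norm_eq_abs]

lemma isLinearMap_sub {V : Type*} [AddCommGroup V] [Module (L0F F P) V] {f g : V → L0F F P}
    (hf : IsLinearMap (L0F F P) f) (hg : IsLinearMap (L0F F P) g) :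
    IsLinearMap (L0F F P) fun x => f x - g x where
  map_add x x' := by rw [hf.map_add, hg.map_add]; abel
  map_smul a x := by rw [hf.map_smul, hg.map_smul, smul_sub]

/-- The difference `f - μ_y` kills simple functions, so its value at `x` equals its value at each `d
n = x - s n`, and by locality at `d_N` for random `N`. There `f` can be made small, while `μ_y` is
controlled by `E[|d K y| | F]` if `N ≥ K`; finally `K → ∞`. -/
lemma eq_muFun_of_nonneg [IsFiniteMeasure P] (hF : F ≤ mΩ) {hφ : IsYoung φ}
    {f : orlicz F P hφ → L0F F P} (hf : f ∈ orderDual hF hφ) {y : Ω →ₘ[P] ℝ}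
    (hy : ∀ x ∈ orlicz F P hφ, x * y ∈ L1F F P) (h : ∀ s : SimpleFunc Ω ℝ, ∀ x : orlicz F P hφ,
      (x : Ω →ₘ[P] ℝ) =ᵐ[P] s → f x = muFun F P hφ y x) {x : orlicz F P hφ}
    (hx : ∀ᵐ ω ∂P, 0 ≤ (x : Ω →ₘ[P] ℝ) ω) : f x - muFun F P hφ y x = 0 := by
  have hlin := isLinearMap_sub hf.1.2 (isLinearMap_muFun hF hφ hy)
  obtain ⟨s, hs0, hsm, hsx⟩ := exists_simple_approx (x : Ω →ₘ[P] ℝ).measurable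
  choose a ha using fun n => exists_simpleElem (P := P) hF hφ (s n)
  have ha' := ae_all_iff.2 ha
  let d : ℕ → orlicz F P hφ := fun n => x - a n
  have hd : ∀ᵐ ω ∂P, ∀ n, (d n : Ω →ₘ[P] ℝ) ω = (x : Ω →ₘ[P] ℝ) ω - s n ω := by
    filter_upwards [ae_all_iff.2 fun n => AEEqFun.coeFn_sub (x : Ω →ₘ[P] ℝ) (a n), ha']
      with ω h1 h2 n
    rw [← h2 n]
    exact h1 n
  have hd0 : ∀ᵐ ω ∂P, ∀ n, 0 ≤ (d n : Ω →ₘ[P] ℝ) ω := by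
    filter_upwards [hd, hx] with ω h1 h2 n
    rw [h1]
    exact sub_nonneg.2 ((hsx ω h2).1 n)
  have hanti : ∀ᵐ ω ∂P, Antitone fun n => (d n : Ω →ₘ[P] ℝ) ω := by
    filter_upwards [hd] with ω h1 m n hmn
    simp only [h1]
    exact sub_le_sub_left (hsm ω hmn) _
  have hlim : ∀ᵐ ω ∂P, Tendsto (fun n => (d n : Ω →ₘ[P] ℝ) ω) atTop (𝓝 0) := by
    filter_upwards [hd, hx] with ω h1 h2
    simp only [h1]
    simpa using (hsx ω h2).2.const_sub ((x : Ω →ₘ[P] ℝ) ω)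
  -- `K` is fixed while the random indices vary: the limit in `j` removes the `f` term and leaves
  -- the bound for `μ_y`.
  have hbound : ∀ K, ∀ᵐ ω ∂P, |(f x - muFun F P hφ y x : L0F F P).1 ω| ≤
      |(condE F P |(d K : Ω →ₘ[P] ℝ) * y| : Ω →ₘ[P] ℝ) ω| := by
    intro K
    obtain ⟨N, D, hN, hNK, hDN, hDlim⟩ := exists_randomIndex_tendsto_zero hF hf d hd0 hanti hlim K
    have hxD : ∀ j, f x - muFun F P hφ y x = f (D j) - muFun F P hφ y (D j) := fun j => by
      refine L0F_ext ?_
      have hk : ∀ k, ∀ᵐ ω ∂P, ω ∈ N j ⁻¹' {k} →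
          (f x - muFun F P hφ y x : L0F F P).1 ω =
            (f (D j) - muFun F P hφ y (D j) : L0F F P).1 ω := fun k => by
        have e := map_eqOn hF hlin (hN j (measurableSet_singleton k)) (x := D j) (x' := d k) (by
          filter_upwards [hDN j] with ω h1 hω
          rw [h1, show N j ω = k from hω])
        have e2 : f (d k) - muFun F P hφ y (d k) = f x - muFun F P hφ y x := by
          have h1 := hlin.map_sub x (a k)
          rw [h (s k) (a k) (ha k), sub_self, sub_zero] at h1
          exact h1
        filter_upwards [e] with ω h1 hω
        rw [h1 hω, e2]
      filter_upwards [ae_all_iff.2 hk] with ω hω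
      exact hω (N j ω) rfl
    have hmu : ∀ j, ∀ᵐ ω ∂P, |(muFun F P hφ y (D j) : Ω →ₘ[P] ℝ) ω| ≤
        (condE F P |(d K : Ω →ₘ[P] ℝ) * y| : Ω →ₘ[P] ℝ) ω := fun j => by
      refine abs_condE_le hF (mem_L1F_abs hF (hy _ (d K).2)) ?_
      filter_upwards [hDN j, hd0, hanti, AEEqFun.coeFn_mul (D j : Ω →ₘ[P] ℝ) y,
        AEEqFun.coeFn_mul (d K : Ω →ₘ[P] ℝ) y, AEEqFun.coeFn_abs ((d K : Ω →ₘ[P] ℝ) * y)]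
        with ω h1 h2 h3 h4 h5 h6
      rw [h4, h6, h5, Pi.mul_apply, Pi.mul_apply, abs_mul, abs_mul, h1, abs_of_nonneg (h2 _),
        abs_of_nonneg (h2 _)]
      exact mul_le_mul_of_nonneg_right (h3 (hNK j ω)) (abs_nonneg _)
    filter_upwards [hDlim, ae_all_iff.2 hmu, ae_all_iff.2 fun j => AEEqFun.coeFn_sub
      (f (D j) : Ω →ₘ[P] ℝ) (muFun F P hφ y (D j))] with ω h1 h2 h3
    have h4 : Tendsto (fun j => |(f (D j) : Ω →ₘ[P] ℝ) ω| +
        |(condE F P |(d K : Ω →ₘ[P] ℝ) * y| : Ω →ₘ[P] ℝ) ω|) atTop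
        (𝓝 (0 + |(condE F P |(d K : Ω →ₘ[P] ℝ) * y| : Ω →ₘ[P] ℝ) ω|)) :=
      ((tendsto_zero_iff_abs_tendsto_zero _).1 h1).add_const _
    rw [zero_add] at h4
    refine ge_of_tendsto' h4 fun j => ?_
    have e3 : (f x - muFun F P hφ y x : L0F F P).1 ω =
        (f (D j) : Ω →ₘ[P] ℝ) ω - (muFun F P hφ y (D j) : Ω →ₘ[P] ℝ) ω := by
      rw [hxD j]
      exact h3 j
    rw [e3]
    exact (abs_sub _ _).trans (add_le_add_right ((h2 j).trans (le_abs_self _)) _)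
  have hz := nonpos_of_le_abs_condE hF (x := fun K => |(d K : Ω →ₘ[P] ℝ) * y|)
    (z := (d 0 : Ω →ₘ[P] ℝ) * y) (v := |(f x - muFun F P hφ y x : L0F F P).1|)
    (hy _ (d 0).2) (fun K => ?_) ?_ fun K => ?_
  · refine L0F_ext ?_
    filter_upwards [hz, AEEqFun.coeFn_abs (f x - muFun F P hφ y x : L0F F P).1,
      AEEqFun.coeFn_zero (μ := P) (α := Ω) (β := ℝ)] with ω h1 h2 h3
    rw [h2] at h1
    rw [Subring.coe_zero, h3, Pi.zero_apply]
    exact abs_nonpos_iff.1 h1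
  · filter_upwards [hd0, hanti, AEEqFun.coeFn_mul (d 0 : Ω →ₘ[P] ℝ) y,
      AEEqFun.coeFn_mul (d K : Ω →ₘ[P] ℝ) y, AEEqFun.coeFn_abs ((d K : Ω →ₘ[P] ℝ) * y)]
      with ω h2 h3 h4 h5 h6
    rw [h6, h4, h5, Pi.mul_apply, Pi.mul_apply, abs_abs, abs_mul, abs_mul, abs_of_nonneg (h2 _),
      abs_of_nonneg (h2 _)]
    exact mul_le_mul_of_nonneg_right (h3 (Nat.zero_le K)) (abs_nonneg _)
  · filter_upwards [hlim, ae_all_iff.2 fun K => AEEqFun.coeFn_mul (d K : Ω →ₘ[P] ℝ) y,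
      ae_all_iff.2 fun K => AEEqFun.coeFn_abs ((d K : Ω →ₘ[P] ℝ) * y)] with ω h1 h2 h3
    simp only [h3, h2, Pi.mul_apply]
    simpa using (h1.mul_const (y ω)).abs
  · filter_upwards [hbound K, AEEqFun.coeFn_abs (f x - muFun F P hφ y x : L0F F P).1] with ω h1 h2
    rwa [h2]

lemma orderDual_subset_image [IsFiniteMeasure P] (hF : F ≤ mΩ) (hφ : IsYoung φ) :
    orderDual hF hφ ⊆ muFun F P hφ '' orliczSet F P (conj φ) := by
  intro f hf
  obtain ⟨y, hyL, hyA⟩ := exists_eq_muFun_indElem hF hf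
  have hs := eq_muFun_of_simple hF hf.1.2 hyL hyA
  have hy : ∀ x ∈ orlicz F P hφ, x * y ∈ L1F F P := fun x hx =>
    mul_mem_L1F_of_eq_muFun hF hf.2.1 hyL hs ⟨x, hx⟩
  have hlin := isLinearMap_sub hf.1.2 (isLinearMap_muFun hF hφ hy)
  refine ⟨y, mem_orliczSet_conj hF hφ hy, funext fun x => (sub_eq_zero.1 ?_).symm⟩
  have habs := AEEqFun.coeFn_abs (x : Ω →ₘ[P] ℝ)
  -- `x` is the difference of the nonnegative elements `|x|` and `|x| - x`.
  let a : orlicz F P hφ := ⟨|(x : Ω →ₘ[P] ℝ)|, mem_orlicz_of_abs_le hφ x.2 (by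
    filter_upwards [habs] with ω h
    rw [h, abs_abs])⟩
  have h1 := eq_muFun_of_nonneg hF hf hy hs (x := a) (coeFn_nonneg (zero_le_abs _))
  have h2 := eq_muFun_of_nonneg hF hf hy hs (x := a - x) (by
    filter_upwards [habs, AEEqFun.coeFn_sub |(x : Ω →ₘ[P] ℝ)| (x : Ω →ₘ[P] ℝ)] with ω h3 h4
    refine le_of_le_of_eq ?_ h4.symm
    rw [Pi.sub_apply, h3]
    exact sub_nonneg.2 (le_abs_self _))
  have h3 := hlin.map_sub a (a - x)
  rw [h1, h2, sub_sub_cancel, sub_zero] at h3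
  exact h3

end CondOrlicz

end

/-! ### The duality theorem -/

open CondOrlicz in
theorem proposition4p8 {Ω : Type*} (F : MeasurableSpace Ω) [mΩ : MeasurableSpace Ω]
    (hF : F ≤ mΩ) (P : MeasureTheory.Measure Ω) [MeasureTheory.IsProbabilityMeasure P]
    (φ : NNReal → ENNReal) (hφ : IsYoung φ) :
    -- every `μ_y` is well defined: `x y ∈ L¹_F` for `x ∈ L^φ_F`, `y ∈ L^{φ*}_F`
    (∀ x ∈ orlicz F P hφ, ∀ y ∈ orliczSet F P (conj φ), x * y ∈ L1F F P) ∧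
    -- the conditionally order continuous functionals are exactly the `μ_y`
    orderDual hF hφ = muFun F P hφ '' orliczSet F P (conj φ) ∧
    -- the same as an equality of conditional sets
    condSet P hF (orderDual hF hφ) = condBuilder P hF (muFun F P hφ '' orliczSet F P (conj φ)) ∧
    -- `y` is determined by `μ_y`
    Set.InjOn (muFun F P hφ) (orliczSet F P (conj φ)) := by
  have heq : orderDual hF hφ = muFun F P hφ '' orliczSet F P (conj φ) := by
    refine Subset.antisymm (orderDual_subset_image hF hφ) ?_
    rintro _ ⟨y, hy, rfl⟩
    exact muFun_mem_orderDual hF hφ fun x hx => mul_mem_L1F hF hφ hx hy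
  refine ⟨fun x hx y hy => mul_mem_L1F hF hφ hx hy, heq, ?_, injOn_muFun hF hφ⟩
  rw [condBuilder, ccHull_image_muFun hF hφ, heq]
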